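/- All Hilbert spaces are finite-dimensional and complex, $\mathcal L(A,B)$ is the space of linear maps $A\to B$, $\mathcal L(A)=\mathcal L(A,A)$, and $X\perp Y$ means $\mathrm{Tr}(X^\dagger Y)=0$. A *non-commutative graph* (nc-graph) is a subspace $S\subseteq\mathcal L(A)$ with $S^\dagger=S$ and $I_A\in S$; write $S^\perp=\{X\in\mathcal L(A): X\perp Y\ \forall\, Y\in S\}$. *Semiring.* Two nc-graphs $S_1,S_2$ are isomorphic if $S_2=U^\dagger S_1U$ for some unitary $U$. Let $\mathcal S$ be the commutative semiring of isomorphism classes of nc-graphs with addition $S_1\oplus S_2\subseteq\mathcal L(A_1)\oplus\mathcal L(A_2)\subseteq\mathcal L(A_1\oplus A_2)$, multiplication $S_1\otimes S_2=\mathrm{span}\{X\otimes Y:X\in S_1,Y\in S_2\}\subseteq\mathcal L(A_1\otimes A_2)$, zero $\overline{\mathcal K_0}$ and one $\overline{\mathcal K_1}$, where $\overline{\mathcal K_n}=\mathrm{span}\{|i\rangle\langle i|:1\le i\le n\}\subseteq\mathcal L(\mathbb C^n)$. *Preorder.* For nc-graphs $S\subseteq\mathcal L(A_1)$ and $T\subseteq\mathcal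 L(A_2)$ write $S\le_*T$ if there are a Hilbert space $A_0$, a positive definite $\rho\in\mathcal L(A_0)$ with $\mathrm{Tr}\,\rho=1$, and finitely many $E_i\in\mathcal L(A_1\otimes A_0,A_2)$ with $\sum_iE_i^\dagger E_i=I$ such that $E_i(X\otimes\rho)E_j^\dagger\perp Y$ for all $X\in S^\perp$, $Y\in T$ and all $i,j$. The *asymptotic spectrum* $\mathbf X(\mathcal S,\le_*)$ is the set of semiring homomorphisms $\varphi:\mathcal S\to\mathbb R_{\ge0}$ such that $S\le_*T$ implies $\varphi(S)\le\varphi(T)$ for all nc-graphs $S,T$. *Capacity.* A size-$k$ *entanglement-assisted independent set* of $S\subseteq\mathcal L(A)$ consists of Hilbert spaces $A_0,B_0$, a unit vector $|\Omega\rangle\in A_0\otimes B_0$, and quantum channels $\mathcal E_1,\dots,\mathcal E_k:\mathcal L(A_0)\to\mathcal L(A)$ with Choi–Kraus operators $\{E_{i,l}\}_l$ (so $\sum_lE_{i,l}^\dagger E_{i,l}=I_{A_0}$) such that $E_{i,l}\,\mathrm{Tr}_{B_0}(|\Omega\rangle\langle\Omega|)\,E_{j,l'}^\dagger\perp Y$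 for all $i\ne j$, all $l,l'$ and all $Y\in S$. Let $\alpha_*(S)$ be the maximum size of an entanglement-assisted independent set of $S$, and let $$\Theta_*(S)=\lim_{N\to\infty}\sqrt[N]{\alpha_*(S^{\otimes N})}$$ be the *entanglement-assisted Shannon capacity* of $S$. **Theorem.** Let $S$ be an nc-graph. Then (the maxima $\alpha_*(S^{\otimes N})$ and the limit $\Theta_*(S)$ exist, and) $$\Theta_*(S)=\min_{\varphi\in\mathbf X(\mathcal S,\le_*)}\varphi(S),$$ where the minimum is attained. -/

import Mathlib

open Matrix Filter Topology
open scoped NNReal Kronecker ComplexOrder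

/-- A non-commutative graph: a complex subspace `S ⊆ L(A)` with `S† = S` and `I ∈ S`, where
`A = ℂ^ι` is a finite-dimensional Hilbert space with orthonormal basis indexed by `ι`
(the zero space is allowed). -/
structure NCGraph : Type 1 where
  ι : Type
  [fintypeι : Fintype ι]
  [decEqι : DecidableEq ι]
  space : Submodule ℂ (Matrix ι ι ℂ)
  conjTranspose_mem : ∀ X ∈ space, Xᴴ ∈ space
  one_mem : (1 : Matrix ι ι ℂ) ∈ space

attribute [instance] NCGraph.fintypeι NCGraph.decEqι

/-- A quantum channel `L(ℂ^α) → L(ℂ^β)`, given by a finite family of Choi–Kraus operators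
`K_i : ℂ^α → ℂ^β` with `∑ K_i† K_i = I`. -/
structure QChannel (α β : Type) [Fintype α] [DecidableEq α] [Fintype β] : Type 1 where
  κ : Type
  [fintypeκ : Fintype κ]
  kraus : κ → Matrix β α ℂ
  sum_eq_one : ∑ i, (kraus i)ᴴ * kraus i = 1

attribute [instance] QChannel.fintypeκ

namespace NCGraph

/-- Orthogonality for the Hilbert–Schmidt inner product `⟨X, Y⟩ = Tr(X† Y)`. -/
def HSOrth {m n : Type} [Fintype m] [Fintype n] (X Y : Matrix m n ℂ) : Prop :=
  (Xᴴ * Y).trace = 0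

/-- `X ∈ S^⊥`, i.e. `Tr(X† Y) = 0` for all `Y ∈ S`. -/
def OrthTo (S : NCGraph) (X : Matrix S.ι S.ι ℂ) : Prop :=
  ∀ Y ∈ S.space, HSOrth X Y

/-- The entanglement-assisted cohomomorphism preorder `S ≤_* T` on nc-graphs `S ⊆ L(A₁)`,
`T ⊆ L(A₂)`: there are a positive definite density matrix `ρ` on some `A₀` and operators
`E_i : A₁ ⊗ A₀ → A₂` with `∑ E_i† E_i = I` such that `E_i (X ⊗ ρ) E_j† ⊥ T` for all
`X ∈ S^⊥` and all `i`, `j`. -/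
def EALE (S T : NCGraph) : Prop :=
  ∃ (α : Type) (_ : Fintype α) (_ : DecidableEq α) (ρ : Matrix α α ℂ)
    (E : QChannel (S.ι × α) T.ι),
    ρ.PosDef ∧ ρ.trace = 1 ∧
    ∀ X, S.OrthTo X → ∀ i j, T.OrthTo (E.kraus i * (X ⊗ₖ ρ) * (E.kraus j)ᴴ)

/-- The reduced state `Tr_B |Ω⟩⟨Ω|` of a vector `Ω ∈ ℂ^α ⊗ ℂ^β`. -/
def reducedState {α β : Type} [Fintype β] (Ω : α × β → ℂ) : Matrix α α ℂ :=
  Matrix.of fun a a' => ∑ b, Ω (a, b) * star (Ω (a', b))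

/-- There is a size-`k` entanglement-assisted independent set of `S ⊆ L(A)`: a shared pure state
`Ω ∈ A₀ ⊗ B₀` and encoding channels `𝓔₁, …, 𝓔_k : L(A₀) → L(A)` with Choi–Kraus operators
`E_{i,l}` such that `E_{i,l} Tr_{B₀}(|Ω⟩⟨Ω|) E_{j,l'}† ⊥ S` whenever `i ≠ j`. -/
def HasEAIndependentSet (S : NCGraph) (k : ℕ) : Prop :=
  ∃ (α β : Type) (_ : Fintype α) (_ : DecidableEq α) (_ : Fintype β) (Ω : α × β → ℂ)
    (E : Fin k → QChannel α S.ι),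
    ∑ x, ‖Ω x‖ ^ 2 = 1 ∧
    ∀ i j, i ≠ j → ∀ l l',
      S.OrthTo ((E i).kraus l * reducedState Ω * ((E j).kraus l')ᴴ)

/-- The entanglement-assisted independence number `α_*(S)`. -/
noncomputable def alphaStar (S : NCGraph) : ℕ :=
  sSup {k | S.HasEAIndependentSet k}

/-- The nc-graph `span {|i⟩⟨i| : i ∈ [n]}` of the noiseless classical channel with `n` messages. -/
abbrev kbar (n : ℕ) : NCGraph where
  ι := Fin n
  space := Submodule.span ℂ (Set.range fun i : Fin n => Matrix.single i i (1 : ℂ))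
  conjTranspose_mem := by
    intro X hX
    induction hX using Submodule.span_induction with
    | mem x h =>
      obtain ⟨i, rfl⟩ := h
      exact Submodule.subset_span ⟨i, by simp [Matrix.conjTranspose_single]⟩
    | zero => simp
    | add x y _ _ hx hy => rw [Matrix.conjTranspose_add]; exact Submodule.add_mem _ hx hy
    | smul a x _ hx => rw [Matrix.conjTranspose_smul]; exact Submodule.smul_mem _ _ hx
  one_mem := by
    have h : (1 : Matrix (Fin n) (Fin n) ℂ) = ∑ i, Matrix.single i i (1 : ℂ) := by
      ext a b
      rw [Matrix.sum_apply, Finset.sum_eq_single a]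
      · simp [Matrix.single_apply, Matrix.one_apply]
      · intro c _ hc
        simp [hc]
      · simp
    rw [h]
    exact Submodule.sum_mem _ fun i _ => Submodule.subset_span ⟨i, rfl⟩

/-- The direct sum `S ⊕ T ⊆ L(A) ⊕ L(B) ⊆ L(A ⊕ B)`. -/
abbrev directSum (S T : NCGraph) : NCGraph where
  ι := S.ι ⊕ T.ι
  space :=
    { carrier := {M | ∃ X ∈ S.space, ∃ Y ∈ T.space, M = Matrix.fromBlocks X 0 0 Y}
      zero_mem' := ⟨0, S.space.zero_mem, 0, T.space.zero_mem, by simp⟩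
      add_mem' := by
        rintro _ _ ⟨X, hX, Y, hY, rfl⟩ ⟨X', hX', Y', hY', rfl⟩
        exact ⟨_, S.space.add_mem hX hX', _, T.space.add_mem hY hY',
          by simp [Matrix.fromBlocks_add]⟩
      smul_mem' := by
        rintro c _ ⟨X, hX, Y, hY, rfl⟩
        exact ⟨_, S.space.smul_mem c hX, _, T.space.smul_mem c hY,
          by simp [Matrix.fromBlocks_smul]⟩ }
  conjTranspose_mem := by
    rintro _ ⟨X, hX, Y, hY, rfl⟩
    exact ⟨_, S.conjTranspose_mem X hX, _, T.conjTranspose_mem Y hY,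
      by simp [Matrix.fromBlocks_conjTranspose]⟩
  one_mem := ⟨1, S.one_mem, 1, T.one_mem, by simp⟩

/-- The tensor product `S ⊗ T = span {X ⊗ Y : X ∈ S, Y ∈ T} ⊆ L(A ⊗ B)`. -/
abbrev tensor (S T : NCGraph) : NCGraph where
  ι := S.ι × T.ι
  space := Submodule.span ℂ {M | ∃ X ∈ S.space, ∃ Y ∈ T.space, M = X ⊗ₖ Y}
  conjTranspose_mem := by
    intro M hM
    induction hM using Submodule.span_induction with
    | mem x h =>
      obtain ⟨X, hX, Y, hY, rfl⟩ := h
      exact Submodule.subset_span ⟨_, S.conjTranspose_mem X hX, _, T.conjTranspose_mem Y hY,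
        Matrix.conjTranspose_kronecker X Y⟩
    | zero => simp
    | add x y _ _ hx hy => rw [Matrix.conjTranspose_add]; exact Submodule.add_mem _ hx hy
    | smul a x _ hx => rw [Matrix.conjTranspose_smul]; exact Submodule.smul_mem _ _ hx
  one_mem := Submodule.subset_span ⟨1, S.one_mem, 1, T.one_mem, by simp⟩

/-- The tensor power `S^{⊗N}`. -/
def tensorPow (S : NCGraph) : ℕ → NCGraph
  | 0 => kbar 1
  | N + 1 => tensor (tensorPow S N) S

/-- The entanglement-assisted Shannon capacity `Θ_*(S) = lim_{N → ∞} α_*(S^{⊗N})^{1/N}`. -/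
noncomputable def thetaStar (S : NCGraph) : ℝ :=
  limUnder atTop fun N : ℕ => ((S.tensorPow N).alphaStar : ℝ) ^ (1 / (N : ℝ))

/-- Isomorphism of nc-graphs: `T = U† S U` for some unitary `U`. -/
def Iso (S T : NCGraph) : Prop :=
  ∃ U : Matrix S.ι T.ι ℂ, U * Uᴴ = 1 ∧ Uᴴ * U = 1 ∧
    (T.space : Set (Matrix T.ι T.ι ℂ)) = (fun X : Matrix S.ι S.ι ℂ => Uᴴ * X * U) '' S.space

theorem Iso.refl (S : NCGraph) : Iso S S :=
  ⟨1, by simp, by simp, by simp⟩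

theorem Iso.symm {S T : NCGraph} (h : Iso S T) : Iso T S := by
  obtain ⟨U, h1, h2, h3⟩ := h
  refine ⟨Uᴴ, by simpa using h2, by simpa using h1, ?_⟩
  rw [h3, Set.image_image]
  have : ∀ X : Matrix S.ι S.ι ℂ, Uᴴᴴ * (Uᴴ * X * U) * Uᴴ = X := fun X => by
    rw [Matrix.conjTranspose_conjTranspose]
    calc U * (Uᴴ * X * U) * Uᴴ = (U * Uᴴ) * X * (U * Uᴴ) := by simp only [Matrix.mul_assoc]
      _ = X := by rw [h1]; simp
  simp only [this, Set.image_id']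

theorem Iso.trans {S T R : NCGraph} (h : Iso S T) (h' : Iso T R) : Iso S R := by
  obtain ⟨U, h1, h2, h3⟩ := h
  obtain ⟨V, k1, k2, k3⟩ := h'
  refine ⟨U * V, ?_, ?_, ?_⟩
  · calc U * V * (U * V)ᴴ = U * (V * Vᴴ) * Uᴴ := by
          simp only [Matrix.conjTranspose_mul, Matrix.mul_assoc]
      _ = 1 := by rw [k1]; simpa using h1
  · calc (U * V)ᴴ * (U * V) = Vᴴ * (Uᴴ * U) * V := by
          simp only [Matrix.conjTranspose_mul, Matrix.mul_assoc]
      _ = 1 := by rw [h2]; simpa using k2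
  · rw [k3, h3, Set.image_image]
    simp only [Matrix.conjTranspose_mul, Matrix.mul_assoc]

/-- Isomorphism as an equivalence relation. -/
instance isoSetoid : Setoid NCGraph where
  r := Iso
  iseqv := ⟨Iso.refl, Iso.symm, Iso.trans⟩

/-- A relabelling of the basis that carries `S` into `T` and back is an isomorphism. -/
theorem Iso.of_equiv {S T : NCGraph} (e : S.ι ≃ T.ι)
    (h : ∀ X ∈ S.space, X.submatrix e.symm e.symm ∈ T.space)
    (h' : ∀ Y ∈ T.space, Y.submatrix e e ∈ S.space) : Iso S T := by
  have key : ∀ X : Matrix S.ι S.ι ℂ,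
      ((1 : Matrix S.ι S.ι ℂ).submatrix id e.symm)ᴴ * X *
        (1 : Matrix S.ι S.ι ℂ).submatrix id e.symm = X.submatrix e.symm e.symm := by
    intro X
    ext a b
    simp [Matrix.mul_apply, Matrix.one_apply, Finset.sum_ite_eq]
  refine ⟨(1 : Matrix S.ι S.ι ℂ).submatrix id e.symm, ?_, ?_, ?_⟩
  · ext a b
    have hs : ∑ x, (1 : Matrix S.ι S.ι ℂ) a (e.symm x) * star ((1 : Matrix S.ι S.ι ℂ) b (e.symm x))
        = ∑ x, (1 : Matrix S.ι S.ι ℂ) a x * star ((1 : Matrix S.ι S.ι ℂ) b x) :=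
      Equiv.sum_comp e.symm
        (fun x => (1 : Matrix S.ι S.ι ℂ) a x * star ((1 : Matrix S.ι S.ι ℂ) b x))
    refine hs.trans ?_
    simp [Matrix.one_apply]
  · have := key 1
    rw [Matrix.mul_one] at this
    rw [this]
    simp
  · ext Y
    simp only [key, Set.mem_image, SetLike.mem_coe]
    constructor
    · intro hY
      exact ⟨_, h' Y hY, by ext; simp⟩
    · rintro ⟨X, hX, rfl⟩
      exact h X hX

theorem Iso.directSum {S S' T T' : NCGraph} (h : Iso S S') (h' : Iso T T') :
    Iso (S.directSum T) (S'.directSum T') := by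
  obtain ⟨U, h1, h2, h3⟩ := h
  obtain ⟨V, k1, k2, k3⟩ := h'
  refine ⟨Matrix.fromBlocks U 0 0 V, ?_, ?_, ?_⟩
  · have h : Matrix.fromBlocks U 0 0 V * (Matrix.fromBlocks U 0 0 V).conjTranspose =
        (1 : Matrix (S.ι ⊕ T.ι) (S.ι ⊕ T.ι) ℂ) := by
      rw [Matrix.fromBlocks_conjTranspose, Matrix.fromBlocks_multiply]
      simp [h1, k1]
    exact h
  · have h : (Matrix.fromBlocks U 0 0 V).conjTranspose * Matrix.fromBlocks U 0 0 V =
        (1 : Matrix (S'.ι ⊕ T'.ι) (S'.ι ⊕ T'.ι) ℂ) := by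
      rw [Matrix.fromBlocks_conjTranspose, Matrix.fromBlocks_multiply]
      simp [h2, k2]
    exact h
  · have hU : ∀ X, X ∈ S'.space ↔ ∃ Z ∈ S.space, Uᴴ * Z * U = X := fun X => by
      rw [← SetLike.mem_coe, h3]; rfl
    have hV : ∀ X, X ∈ T'.space ↔ ∃ Z ∈ T.space, Vᴴ * Z * V = X := fun X => by
      rw [← SetLike.mem_coe, k3]; rfl
    have key : ∀ (X : Matrix S.ι S.ι ℂ) (Y : Matrix T.ι T.ι ℂ),
        (Matrix.fromBlocks U 0 0 V).conjTranspose * Matrix.fromBlocks X 0 0 Y *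
        Matrix.fromBlocks U 0 0 V = Matrix.fromBlocks (U.conjTranspose * X * U) 0 0
          (V.conjTranspose * Y * V) := by
      intro X Y
      simp [Matrix.fromBlocks_conjTranspose, Matrix.fromBlocks_multiply]
    ext M
    constructor
    · rintro ⟨X, hX, Y, hY, rfl⟩
      obtain ⟨X₀, hX₀, rfl⟩ := (hU _).1 hX
      obtain ⟨Y₀, hY₀, rfl⟩ := (hV _).1 hY
      exact ⟨_, ⟨X₀, hX₀, Y₀, hY₀, rfl⟩, key X₀ Y₀⟩
    · rintro ⟨_, ⟨X, hX, Y, hY, rfl⟩, rfl⟩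
      exact ⟨_, (hU _).2 ⟨X, hX, rfl⟩, _, (hV _).2 ⟨Y, hY, rfl⟩, key X Y⟩

theorem tensor_le {S T : NCGraph} {P : Submodule ℂ (Matrix (S.ι × T.ι) (S.ι × T.ι) ℂ)}
    (h : ∀ X ∈ S.space, ∀ Y ∈ T.space, X ⊗ₖ Y ∈ P) : (S.tensor T).space ≤ P := by
  refine Submodule.span_le.2 ?_
  rintro _ ⟨X, hX, Y, hY, rfl⟩
  exact h X hX Y hY

theorem kronecker_mem {S T : NCGraph} {X : Matrix S.ι S.ι ℂ} {Y : Matrix T.ι T.ι ℂ}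
    (hX : X ∈ S.space) (hY : Y ∈ T.space) : X ⊗ₖ Y ∈ (S.tensor T).space := by
  show X ⊗ₖ Y ∈ Submodule.span ℂ {M | ∃ X ∈ S.space, ∃ Y ∈ T.space, M = X ⊗ₖ Y}
  exact Submodule.subset_span ⟨X, hX, Y, hY, rfl⟩

theorem Iso.tensor {S S' T T' : NCGraph} (h : Iso S S') (h' : Iso T T') :
    Iso (S.tensor T) (S'.tensor T') := by
  obtain ⟨U, h1, h2, h3⟩ := h
  obtain ⟨V, k1, k2, k3⟩ := h'
  refine ⟨U ⊗ₖ V, ?_, ?_, ?_⟩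
  · have h : (U ⊗ₖ V) * (U ⊗ₖ V).conjTranspose =
        (1 : Matrix (S.ι × T.ι) (S.ι × T.ι) ℂ) := by
      rw [Matrix.conjTranspose_kronecker, ← Matrix.mul_kronecker_mul, h1, k1]
      exact Matrix.one_kronecker_one
    exact h
  · have h : (U ⊗ₖ V).conjTranspose * (U ⊗ₖ V) =
        (1 : Matrix (S'.ι × T'.ι) (S'.ι × T'.ι) ℂ) := by
      rw [Matrix.conjTranspose_kronecker, ← Matrix.mul_kronecker_mul, h2, k2]
      exact Matrix.one_kronecker_one
    exact h
  · have hU : ∀ X, X ∈ S'.space ↔ ∃ Z ∈ S.space, Uᴴ * Z * U = X := fun X => by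
      rw [← SetLike.mem_coe, h3]; rfl
    have hV : ∀ X, X ∈ T'.space ↔ ∃ Z ∈ T.space, Vᴴ * Z * V = X := fun X => by
      rw [← SetLike.mem_coe, k3]; rfl
    have key : ∀ (X : Matrix S.ι S.ι ℂ) (Y : Matrix T.ι T.ι ℂ),
        (U ⊗ₖ V).conjTranspose * (X ⊗ₖ Y) * (U ⊗ₖ V) =
          (U.conjTranspose * X * U) ⊗ₖ (V.conjTranspose * Y * V) := by
      intro X Y
      rw [Matrix.conjTranspose_kronecker, ← Matrix.mul_kronecker_mul, ← Matrix.mul_kronecker_mul]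
    let f : Matrix (S.ι × T.ι) (S.ι × T.ι) ℂ →ₗ[ℂ] Matrix (S'.ι × T'.ι) (S'.ι × T'.ι) ℂ :=
      { toFun := fun X => (U ⊗ₖ V).conjTranspose * X * (U ⊗ₖ V)
        map_add' := fun X Y => by rw [Matrix.mul_add, Matrix.add_mul]
        map_smul' := fun c X => by simp }
    have e1 : (S'.tensor T').space ≤ (S.tensor T).space.map f := by
      refine tensor_le fun X hX Y hY => ?_
      obtain ⟨X₀, hX₀, rfl⟩ := (hU _).1 hX
      obtain ⟨Y₀, hY₀, rfl⟩ := (hV _).1 hY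
      exact ⟨X₀ ⊗ₖ Y₀, kronecker_mem hX₀ hY₀, key X₀ Y₀⟩
    have e2 : (S.tensor T).space ≤ (S'.tensor T').space.comap f := by
      refine tensor_le fun X hX Y hY => ?_
      show f (X ⊗ₖ Y) ∈ (S'.tensor T').space
      have hk : f (X ⊗ₖ Y) = (U.conjTranspose * X * U) ⊗ₖ (V.conjTranspose * Y * V) := key X Y
      rw [hk]
      exact kronecker_mem ((hU _).2 ⟨X, hX, rfl⟩) ((hV _).2 ⟨Y, hY, rfl⟩)
    ext M
    constructor
    · intro hM
      exact e1 hM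
    · rintro ⟨X, hX, rfl⟩
      exact e2 hX

theorem mem_of_eq {S : NCGraph} {X Y : Matrix S.ι S.ι ℂ} (hY : Y ∈ S.space) (h : X = Y) :
    X ∈ S.space := h ▸ hY

/-- To relate tensor products it suffices to relate pure tensors. -/
theorem tensor_submatrix_mem {S T R : NCGraph} (f : R.ι → S.ι × T.ι)
    (h : ∀ X ∈ S.space, ∀ Y ∈ T.space, (X ⊗ₖ Y).submatrix f f ∈ R.space) :
    ∀ M ∈ (S.tensor T).space, M.submatrix f f ∈ R.space := by
  intro M hM
  induction hM using Submodule.span_induction with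
  | mem x hx => obtain ⟨X, hX, Y, hY, rfl⟩ := hx; exact h X hX Y hY
  | zero => exact R.space.zero_mem
  | add x y _ _ hx hy => exact R.space.add_mem hx hy
  | smul a x _ hx => exact R.space.smul_mem a hx

theorem directSum_comm (S T : NCGraph) : Iso (S.directSum T) (T.directSum S) := by
  refine Iso.of_equiv (Equiv.sumComm S.ι T.ι) ?_ ?_
  · rintro _ ⟨X, hX, Y, hY, rfl⟩
    exact ⟨Y, hY, X, hX, by ext (_ | _) (_ | _) <;> rfl⟩
  · rintro _ ⟨X, hX, Y, hY, rfl⟩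
    exact ⟨Y, hY, X, hX, by ext (_ | _) (_ | _) <;> rfl⟩

theorem directSum_assoc (S T R : NCGraph) :
    Iso ((S.directSum T).directSum R) (S.directSum (T.directSum R)) := by
  refine Iso.of_equiv (Equiv.sumAssoc S.ι T.ι R.ι) ?_ ?_
  · rintro _ ⟨_, ⟨X, hX, Y, hY, rfl⟩, Z, hZ, rfl⟩
    exact ⟨X, hX, _, ⟨Y, hY, Z, hZ, rfl⟩, by ext (_ | _ | _) (_ | _ | _) <;> rfl⟩
  · rintro _ ⟨X, hX, _, ⟨Y, hY, Z, hZ, rfl⟩, rfl⟩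
    exact ⟨_, ⟨X, hX, Y, hY, rfl⟩, Z, hZ, by ext ((_ | _) | _) ((_ | _) | _) <;> rfl⟩

theorem directSum_zero (S : NCGraph) : Iso (S.directSum (kbar 0)) S := by
  refine Iso.of_equiv (Equiv.sumEmpty S.ι (Fin 0)) ?_ ?_
  · rintro _ ⟨X, hX, Y, hY, rfl⟩
    exact hX
  · intro X hX
    refine ⟨X, hX, 0, Submodule.zero_mem _, ?_⟩
    ext (a | a) (b | b)
    · rfl
    · exact Fin.elim0 b
    · exact Fin.elim0 a
    · exact Fin.elim0 a

theorem tensor_comm (S T : NCGraph) : Iso (S.tensor T) (T.tensor S) := by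
  refine Iso.of_equiv (Equiv.prodComm S.ι T.ι) ?_ ?_
  · refine tensor_submatrix_mem (R := T.tensor S) _ fun X hX Y hY => ?_
    refine mem_of_eq (kronecker_mem hY hX) ?_
    ext ⟨a, b⟩ ⟨c, d⟩
    exact mul_comm _ _
  · refine tensor_submatrix_mem (R := S.tensor T) _ fun X hX Y hY => ?_
    refine mem_of_eq (kronecker_mem hY hX) ?_
    ext ⟨a, b⟩ ⟨c, d⟩
    exact mul_comm _ _

theorem tensor_assoc (S T R : NCGraph) :
    Iso ((S.tensor T).tensor R) (S.tensor (T.tensor R)) := by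
  refine Iso.of_equiv (Equiv.prodAssoc S.ι T.ι R.ι) ?_ ?_
  · refine tensor_submatrix_mem (R := S.tensor (T.tensor R)) _ fun M hM Z hZ => ?_
    induction hM using Submodule.span_induction with
    | mem x hx =>
      obtain ⟨X, hX, Y, hY, rfl⟩ := hx
      refine mem_of_eq (kronecker_mem hX (kronecker_mem hY hZ)) ?_
      ext ⟨a, b, c⟩ ⟨d, e, f⟩
      exact mul_assoc _ _ _
    | zero => rw [Matrix.zero_kronecker]; exact Submodule.zero_mem _
    | add x y _ _ hx hy => rw [Matrix.add_kronecker]; exact Submodule.add_mem _ hx hy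
    | smul a x _ hx => rw [Matrix.smul_kronecker]; exact Submodule.smul_mem _ a hx
  · refine tensor_submatrix_mem (R := (S.tensor T).tensor R) _ fun X hX M hM => ?_
    induction hM using Submodule.span_induction with
    | mem x hx =>
      obtain ⟨Y, hY, Z, hZ, rfl⟩ := hx
      refine mem_of_eq (kronecker_mem (kronecker_mem hX hY) hZ) ?_
      ext ⟨⟨a, b⟩, c⟩ ⟨⟨d, e⟩, f⟩
      exact (mul_assoc _ _ _).symm
    | zero => rw [Matrix.kronecker_zero]; exact Submodule.zero_mem _
    | add x y _ _ hx hy => rw [Matrix.kronecker_add]; exact Submodule.add_mem _ hx hy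
    | smul a x _ hx => rw [Matrix.kronecker_smul]; exact Submodule.smul_mem _ a hx

theorem tensor_one (S : NCGraph) : Iso (S.tensor (kbar 1)) S := by
  refine Iso.of_equiv (Equiv.prodUnique S.ι (Fin 1)) ?_ ?_
  · refine tensor_submatrix_mem (R := S) _ fun X hX Y hY => ?_
    refine mem_of_eq (S.space.smul_mem (Y (0 : Fin 1) (0 : Fin 1)) hX) ?_
    ext a b
    exact mul_comm _ _
  · intro X hX
    refine mem_of_eq (kronecker_mem hX (kbar 1).one_mem) ?_
    ext ⟨a, b⟩ ⟨c, d⟩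
    have hb : b = (0 : Fin 1) := Subsingleton.elim (α := Fin 1) b 0
    have hd : d = (0 : Fin 1) := Subsingleton.elim (α := Fin 1) d 0
    subst hb hd
    exact (mul_one _).symm

theorem tensor_zero (S : NCGraph) : Iso (S.tensor (kbar 0)) (kbar 0) := by
  refine Iso.of_equiv (Equiv.equivOfIsEmpty (S.ι × Fin 0) (Fin 0)) ?_ ?_
  · intro X _
    have h : X.submatrix (Equiv.equivOfIsEmpty (S.ι × Fin 0) (Fin 0)).symm
        (Equiv.equivOfIsEmpty (S.ι × Fin 0) (Fin 0)).symm = 0 := by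
      ext a
      exact Fin.elim0 a
    exact h ▸ (kbar 0).space.zero_mem
  · intro X _
    have h : X.submatrix (Equiv.equivOfIsEmpty (S.ι × Fin 0) (Fin 0))
        (Equiv.equivOfIsEmpty (S.ι × Fin 0) (Fin 0)) = 0 := by
      ext a
      exact Fin.elim0 a.2
    exact h ▸ (S.tensor (kbar 0)).space.zero_mem

theorem tensor_directSum (S T R : NCGraph) :
    Iso (S.tensor (T.directSum R)) ((S.tensor T).directSum (S.tensor R)) := by
  refine Iso.of_equiv (Equiv.prodSumDistrib S.ι T.ι R.ι) ?_ ?_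
  · refine tensor_submatrix_mem (R := (S.tensor T).directSum (S.tensor R)) _ ?_
    rintro X hX _ ⟨Y, hY, Z, hZ, rfl⟩
    refine ⟨_, kronecker_mem hX hY, _, kronecker_mem hX hZ, ?_⟩
    ext (⟨a, b⟩ | ⟨a, b⟩) (⟨c, d⟩ | ⟨c, d⟩)
    · rfl
    · exact mul_zero _
    · exact mul_zero _
    · rfl
  · rintro _ ⟨M, hM, N, hN, rfl⟩
    have h1 : ∀ M ∈ (S.tensor T).space,
        (Matrix.fromBlocks M 0 0 (0 : Matrix (S.ι × R.ι) (S.ι × R.ι) ℂ)).submatrix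
          (Equiv.prodSumDistrib S.ι T.ι R.ι) (Equiv.prodSumDistrib S.ι T.ι R.ι) ∈
          (S.tensor (T.directSum R)).space := by
      intro M hM
      induction hM using Submodule.span_induction with
      | mem x hx =>
        obtain ⟨X, hX, Y, hY, rfl⟩ := hx
        refine mem_of_eq (kronecker_mem (T := T.directSum R) hX
          ⟨Y, hY, 0, R.space.zero_mem, rfl⟩) ?_
        ext ⟨a, b | b⟩ ⟨c, d | d⟩
        · rfl
        · exact (mul_zero _).symm
        · exact (mul_zero _).symm
        · exact (mul_zero _).symm
      | zero =>
        refine mem_of_eq (Submodule.zero_mem _) ?_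
        ext ⟨a, b | b⟩ ⟨c, d | d⟩ <;> rfl
      | add x y _ _ hx hy =>
        refine mem_of_eq (Submodule.add_mem _ hx hy) ?_
        ext ⟨a, b | b⟩ ⟨c, d | d⟩
        · rfl
        · exact (add_zero _).symm
        · exact (add_zero _).symm
        · exact (add_zero _).symm
      | smul r x _ hx =>
        refine mem_of_eq (Submodule.smul_mem _ r hx) ?_
        ext ⟨a, b | b⟩ ⟨c, d | d⟩
        · rfl
        · exact (mul_zero _).symm
        · exact (mul_zero _).symm
        · exact (mul_zero _).symm
    have h2 : ∀ N ∈ (S.tensor R).space,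
        (Matrix.fromBlocks (0 : Matrix (S.ι × T.ι) (S.ι × T.ι) ℂ) 0 0 N).submatrix
          (Equiv.prodSumDistrib S.ι T.ι R.ι) (Equiv.prodSumDistrib S.ι T.ι R.ι) ∈
          (S.tensor (T.directSum R)).space := by
      intro N hN
      induction hN using Submodule.span_induction with
      | mem x hx =>
        obtain ⟨X, hX, Y, hY, rfl⟩ := hx
        refine mem_of_eq (kronecker_mem (T := T.directSum R) hX
          ⟨0, T.space.zero_mem, Y, hY, rfl⟩) ?_
        ext ⟨a, b | b⟩ ⟨c, d | d⟩
        · exact (mul_zero _).symm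
        · exact (mul_zero _).symm
        · exact (mul_zero _).symm
        · rfl
      | zero =>
        refine mem_of_eq (Submodule.zero_mem _) ?_
        ext ⟨a, b | b⟩ ⟨c, d | d⟩ <;> rfl
      | add x y _ _ hx hy =>
        refine mem_of_eq (Submodule.add_mem _ hx hy) ?_
        ext ⟨a, b | b⟩ ⟨c, d | d⟩
        · exact (add_zero _).symm
        · exact (add_zero _).symm
        · exact (add_zero _).symm
        · rfl
      | smul r x _ hx =>
        refine mem_of_eq (Submodule.smul_mem _ r hx) ?_
        ext ⟨a, b | b⟩ ⟨c, d | d⟩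
        · exact (mul_zero _).symm
        · exact (mul_zero _).symm
        · exact (mul_zero _).symm
        · rfl
    refine mem_of_eq (Submodule.add_mem _ (h1 M hM) (h2 N hN)) ?_
    ext ⟨a, b | b⟩ ⟨c, d | d⟩
    · exact (add_zero _).symm
    · exact (add_zero _).symm
    · exact (add_zero _).symm
    · exact (zero_add _).symm

end NCGraph

/-- The set `𝒮` of isomorphism classes of nc-graphs. -/
def NCGraphClass : Type 1 := Quotient NCGraph.isoSetoid

/-- The isomorphism class of an nc-graph. -/
def NCGraph.toClass (S : NCGraph) : NCGraphClass := Quotient.mk NCGraph.isoSetoid S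

namespace NCGraphClass

instance : Zero NCGraphClass := ⟨(NCGraph.kbar 0).toClass⟩

instance : One NCGraphClass := ⟨(NCGraph.kbar 1).toClass⟩

instance : Add NCGraphClass :=
  ⟨Quotient.map₂ NCGraph.directSum fun _ _ h _ _ h' => NCGraph.Iso.directSum h h'⟩

instance : Mul NCGraphClass :=
  ⟨Quotient.map₂ NCGraph.tensor fun _ _ h _ _ h' => NCGraph.Iso.tensor h h'⟩

/-- The commutative semiring `(𝒮, ⊕, ⊗, K̄₀, K̄₁)`. -/
instance : CommSemiring NCGraphClass where
  nsmul := nsmulRec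
  npow := npowRec
  add_assoc := by
    rintro ⟨S⟩ ⟨T⟩ ⟨R⟩
    exact Quotient.sound (NCGraph.directSum_assoc S T R)
  add_comm := by
    rintro ⟨S⟩ ⟨T⟩
    exact Quotient.sound (NCGraph.directSum_comm S T)
  add_zero := by
    rintro ⟨S⟩
    exact Quotient.sound (NCGraph.directSum_zero S)
  zero_add := by
    rintro ⟨S⟩
    exact Quotient.sound ((NCGraph.directSum_comm _ S).trans (NCGraph.directSum_zero S))
  mul_assoc := by
    rintro ⟨S⟩ ⟨T⟩ ⟨R⟩
    exact Quotient.sound (NCGraph.tensor_assoc S T R)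
  mul_comm := by
    rintro ⟨S⟩ ⟨T⟩
    exact Quotient.sound (NCGraph.tensor_comm S T)
  mul_one := by
    rintro ⟨S⟩
    exact Quotient.sound (NCGraph.tensor_one S)
  one_mul := by
    rintro ⟨S⟩
    exact Quotient.sound ((NCGraph.tensor_comm _ S).trans (NCGraph.tensor_one S))
  mul_zero := by
    rintro ⟨S⟩
    exact Quotient.sound (NCGraph.tensor_zero S)
  zero_mul := by
    rintro ⟨S⟩
    exact Quotient.sound ((NCGraph.tensor_comm _ S).trans (NCGraph.tensor_zero S))
  left_distrib := by
    rintro ⟨S⟩ ⟨T⟩ ⟨R⟩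
    exact Quotient.sound (NCGraph.tensor_directSum S T R)
  right_distrib := by
    rintro ⟨S⟩ ⟨T⟩ ⟨R⟩
    exact Quotient.sound ((NCGraph.tensor_comm _ R).trans ((NCGraph.tensor_directSum R S T).trans
      (NCGraph.Iso.directSum (NCGraph.tensor_comm R S) (NCGraph.tensor_comm R T))))

end NCGraphClass

/-- The asymptotic spectrum `X(𝒮, ≤_*)`: the semiring homomorphisms `φ : 𝒮 → ℝ≥0` that are
monotone for the entanglement-assisted cohomomorphism preorder. -/
def asymptoticSpectrumEA : Set (NCGraphClass →+* ℝ≥0) :=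
  {φ | ∀ S T : NCGraph, S.EALE T → φ S.toClass ≤ φ T.toClass}

/-- A preorder on a commutative semiring that is compatible with the operations and for which
every nonzero element lies between `1` and some natural number. -/
structure IsStrassenPreorder {R : Type*} [CommSemiring R] (le : R → R → Prop) : Prop where
  refl : ∀ x, le x x
  trans : ∀ {x y z}, le x y → le y z → le x z
  add_right : ∀ {x y} z, le x y → le (x + z) (y + z)
  mul_right : ∀ {x y} z, le x y → le (x * z) (y * z)
  zero_le_one : le 0 1
  one_le : ∀ x, x = 0 ∨ le 1 x
  le_nat : ∀ x, ∃ n : ℕ, le x n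

namespace IsStrassenPreorder

variable {R : Type*} [CommSemiring R] {le : R → R → Prop}

theorem conv (_ : IsStrassenPreorder le) {x y x' y' : R} (hxy : le x y) (hx : x' = x)
    (hy : y' = y) : le x' y' := by subst hx hy; exact hxy

theorem add (h : IsStrassenPreorder le) {x y x' y' : R} (h1 : le x y) (h2 : le x' y') :
    le (x + x') (y + y') :=
  h.trans (h.add_right x' h1) (h.conv (h.add_right y h2) (add_comm _ _) (add_comm _ _))

theorem add_left (h : IsStrassenPreorder le) {x y : R} (z : R) (h1 : le x y) :
    le (z + x) (z + y) := h.add (h.refl z) h1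

theorem mul_left (h : IsStrassenPreorder le) {x y : R} (z : R) (h1 : le x y) :
    le (z * x) (z * y) := h.conv (h.mul_right z h1) (mul_comm _ _) (mul_comm _ _)

theorem mul (h : IsStrassenPreorder le) {x y x' y' : R} (h1 : le x y) (h2 : le x' y') :
    le (x * x') (y * y') := h.trans (h.mul_right x' h1) (h.mul_left y h2)

theorem pow (h : IsStrassenPreorder le) {x y : R} (h1 : le x y) (n : ℕ) :
    le (x ^ n) (y ^ n) := by
  induction n with
  | zero => simpa using h.refl 1
  | succ n ih => rw [pow_succ, pow_succ]; exact h.mul ih h1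

theorem zero_le (h : IsStrassenPreorder le) (x : R) : le 0 x := by
  rcases h.one_le x with rfl | hx
  · exact h.refl _
  · exact h.trans h.zero_le_one hx

theorem le_add_right (h : IsStrassenPreorder le) (x y : R) : le x (x + y) :=
  h.conv (h.add_left x (h.zero_le y)) (add_zero x).symm rfl

theorem le_add_left (h : IsStrassenPreorder le) (x y : R) : le x (y + x) :=
  h.conv (h.le_add_right x y) rfl (add_comm _ _)

theorem natCast (h : IsStrassenPreorder le) {n m : ℕ} (hnm : n ≤ m) : le (n : R) m := by
  obtain ⟨k, rfl⟩ := Nat.exists_eq_add_of_le hnm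
  rw [Nat.cast_add]
  exact h.le_add_right _ _

theorem one_le_pow (h : IsStrassenPreorder le) {x : R} (hx : le 1 x) (n : ℕ) : le 1 (x ^ n) := by
  simpa using h.pow hx n

theorem nsmul_add_le (h : IsStrassenPreorder le) {w c d : R} (hw : le (w + c) (c + d)) (k : ℕ) :
    le (k * w + c) (c + k * d) := by
  induction k with
  | zero => simpa using h.refl c
  | succ k ih =>
    refine h.trans (h.conv (h.add_left w ih) (y' := (w + c) + k * d) ?_ ?_)
      (h.conv (h.add_right (k * d) hw) rfl ?_)
    · push_cast; ring
    · ring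
    · push_cast; ring

theorem not_add_le_self (h : IsStrassenPreorder le) (hnd : ∀ n : ℕ, ¬ le (n + 1 : R) n) {w c : R}
    (hw : le 1 w) : ¬ le (w + c) c := by
  intro hc
  obtain ⟨n, hn⟩ := h.le_nat c
  have h1 := h.nsmul_add_le (d := 0) (by simpa using hc) (n + 1)
  refine hnd n ?_
  refine h.trans ?_ (h.trans h1 (by simpa using hn))
  refine h.trans ?_ (h.le_add_right _ _)
  exact h.conv (h.mul_left ((n + 1 : ℕ) : R) hw) (by simp) rfl

theorem exists_telescope (u p : R) (N : ℕ) :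
    ∃ W Z : R, W = p ^ N + Z ∧ u * W + p ^ (N + 1) = p * W + u ^ (N + 1) := by
  induction N with
  | zero => exact ⟨1, 0, by simp, by ring⟩
  | succ N ih =>
    obtain ⟨W, Z, -, hW⟩ := ih
    refine ⟨p ^ (N + 1) + u * W, u * W, rfl, ?_⟩
    calc u * (p ^ (N + 1) + u * W) + p ^ (N + 1 + 1)
        = u * (u * W + p ^ (N + 1)) + p ^ (N + 1 + 1) := by ring
      _ = p * (p ^ (N + 1) + u * W) + u ^ (N + 1 + 1) := by rw [hW]; ring

/-- An inequality involving `p` and `u` can be turned into one involving powers of them. -/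
theorem amplify (h : IsStrassenPreorder le) {c s x y u p : R}
    (hle : le (c + 1 + s * p + x) (c + s * u + y)) (N : ℕ) :
    ∃ c' W : R, le (p ^ N) W ∧
      le (c' + W + s * p ^ (N + 1) + W * x) (c' + s * u ^ (N + 1) + W * y) := by
  obtain ⟨W, Z, hZ, hW⟩ := exists_telescope u p N
  refine ⟨c * W + s * p * W, W, hZ ▸ h.le_add_right _ _, ?_⟩
  refine h.conv (h.add_right (s * p ^ (N + 1)) (h.mul_right W hle)) (by ring) ?_
  calc c * W + s * p * W + s * u ^ (N + 1) + W * y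
      = c * W + s * (p * W + u ^ (N + 1)) + W * y := by ring
    _ = (c + s * u + y) * W + s * p ^ (N + 1) := by rw [← hW]; ring

/-- The preorder obtained from `le` by adding the relation `u ≤ v`. -/
def adjoin (le : R → R → Prop) (u v : R) : R → R → Prop :=
  fun x y => ∃ t, le (x + t * v) (y + t * u)

theorem le_adjoin {u v x y : R} (hxy : le x y) : adjoin le u v x y :=
  ⟨0, by simpa using hxy⟩

theorem adjoin_self (h : IsStrassenPreorder le) (u v : R) : adjoin le u v u v :=
  ⟨1, h.conv (h.refl (u + v)) (by ring) (by ring)⟩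

theorem isStrassenPreorder_adjoin (h : IsStrassenPreorder le) (u v : R) :
    IsStrassenPreorder (adjoin le u v) where
  refl x := le_adjoin (h.refl x)
  trans := by
    rintro x y z ⟨s, hs⟩ ⟨t, ht⟩
    refine ⟨s + t, h.trans (h.conv (h.add_right (t * v) hs) ?_ rfl)
      (h.conv (h.add_right (s * u) ht) ?_ ?_)⟩ <;> ring
  add_right := by
    rintro x y z ⟨s, hs⟩
    exact ⟨s, h.conv (h.add_right z hs) (by ring) (by ring)⟩
  mul_right := by
    rintro x y z ⟨s, hs⟩
    exact ⟨s * z, h.conv (h.mul_right z hs) (by ring) (by ring)⟩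
  zero_le_one := le_adjoin h.zero_le_one
  one_le x := (h.one_le x).imp_right le_adjoin
  le_nat x := (h.le_nat x).imp fun _ => le_adjoin

/-- Preorders that leave room for a monotone homomorphism with value at most `θ` at `a`. -/
def Admissible (a : R) (θ : ℝ) (le : R → R → Prop) : Prop :=
  ∀ (c s : R) (n M : ℕ), 1 ≤ M → θ ^ M < n → ¬ le (c + 1 + s * n) (c + s * a ^ M)

theorem Admissible.nondegenerate {a : R} {θ : ℝ} (ha : Admissible a θ le) (c : R) :
    ¬ le (c + 1) c := by
  obtain ⟨n, hn⟩ := exists_nat_gt (θ ^ 1)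
  simpa using ha c 0 n 1 le_rfl hn

theorem exists_maximal (h : IsStrassenPreorder le) {a : R} {θ : ℝ} (ha : Admissible a θ le) :
    ∃ P : R → R → Prop, (∀ x y, le x y → P x y) ∧
      Maximal (fun P : R → R → Prop => IsStrassenPreorder P ∧ Admissible a θ P) P := by
  refine zorn_le_nonempty₀ {P : R → R → Prop | IsStrassenPreorder P ∧ Admissible a θ P} ?_ le
    ⟨h, ha⟩
  intro C hC hchain P₀ hP₀
  refine ⟨fun x y => ∃ P ∈ C, P x y, ⟨⟨?_, ?_, ?_, ?_, ?_, ?_, ?_⟩, ?_⟩,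
    fun P hP x y hxy => ⟨P, hP, hxy⟩⟩
  · exact fun x => ⟨P₀, hP₀, (hC hP₀).1.refl x⟩
  · rintro x y z ⟨P, hP, hxy⟩ ⟨Q, hQ, hyz⟩
    rcases hchain.total hP hQ with hPQ | hPQ
    · exact ⟨Q, hQ, (hC hQ).1.trans (hPQ _ _ hxy) hyz⟩
    · exact ⟨P, hP, (hC hP).1.trans hxy (hPQ _ _ hyz)⟩
  · rintro x y z ⟨P, hP, hxy⟩
    exact ⟨P, hP, (hC hP).1.add_right z hxy⟩
  · rintro x y z ⟨P, hP, hxy⟩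
    exact ⟨P, hP, (hC hP).1.mul_right z hxy⟩
  · exact ⟨P₀, hP₀, (hC hP₀).1.zero_le_one⟩
  · exact fun x => ((hC hP₀).1.one_le x).imp_right fun hx => ⟨P₀, hP₀, hx⟩
  · exact fun x => ((hC hP₀).1.le_nat x).imp fun n hx => ⟨P₀, hP₀, hx⟩
  · rintro c s n M hM hn ⟨P, hP, hxy⟩
    exact (hC hP).2 c s n M hM hn hxy

theorem adjoin_of_maximal {a : R} {θ : ℝ}
    (hmax : Maximal (fun P : R → R → Prop => IsStrassenPreorder P ∧ Admissible a θ P) le)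
    {u v : R} (huv : Admissible a θ (adjoin le u v)) : le u v :=
  hmax.2 ⟨isStrassenPreorder_adjoin hmax.1.1 u v, huv⟩ (fun _ _ => le_adjoin) u v
    (adjoin_self hmax.1.1 u v)

theorem pow_le_of_maximal {a : R} {θ : ℝ} (hθ : 0 ≤ θ)
    (hmax : Maximal (fun P : R → R → Prop => IsStrassenPreorder P ∧ Admissible a θ P) le)
    {n M : ℕ} (hM : 1 ≤ M) (hn : θ ^ M < n) : le (a ^ M) n := by
  have h := hmax.1.1
  have hone : ∀ {m K : ℕ} (_ : θ ^ K < m) (j : ℕ), le 1 ((m : R) ^ j) := by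
    intro m K hm j
    have hm' : 1 ≤ m := by
      have : (0 : ℝ) < m := (pow_nonneg hθ K).trans_lt hm
      exact_mod_cast this
    exact h.one_le_pow (by simpa using h.natCast hm') j
  refine adjoin_of_maximal hmax ?_
  rintro c s n' M' hM' hn' ⟨t, ht⟩
  obtain ⟨N, rfl⟩ := Nat.exists_eq_add_of_le' hM
  obtain ⟨N', rfl⟩ := Nat.exists_eq_add_of_le' hM'
  obtain ⟨c₁, W, hW, h1⟩ := h.amplify ht N
  have h2 : le (c₁ + 1 + (W * t) * n + s * n' ^ (N + 1))
      (c₁ + (W * t) * a ^ (N + 1) + s * (a ^ (N' + 1)) ^ (N + 1)) := by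
    have hW1 := h.trans (hone hn' N) hW
    refine h.trans (h.conv (h.add_right (c₁ + s * n' ^ (N + 1) + W * (t * n)) hW1)
      (by ring) rfl) (h.conv h1 (by ring) (by ring))
  obtain ⟨c₂, W₂, hW₂, h3⟩ := h.amplify h2 N'
  have hW1 := h.trans (hone hn N') hW₂
  set m := min (n ^ (N' + 1)) (n' ^ (N + 1)) with hm
  refine hmax.1.2 c₂ (W * t + W₂ * s) m ((N + 1) * (N' + 1)) (by nlinarith) ?_ ?_
  · rw [hm]
    push_cast
    refine lt_min ?_ ?_
    · rw [pow_mul]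
      exact pow_lt_pow_left₀ hn (by positivity) (by omega)
    · rw [mul_comm, pow_mul]
      exact pow_lt_pow_left₀ hn' (by positivity) (by omega)
  · have e1 : le ((m : ℕ) : R) ((n : R) ^ (N' + 1)) := by
      rw [← Nat.cast_pow]; exact h.natCast (min_le_left _ _)
    have e2 : le ((m : ℕ) : R) ((n' : R) ^ (N + 1)) := by
      rw [← Nat.cast_pow]; exact h.natCast (min_le_right _ _)
    have e3 := h.add (h.add_left c₂ hW1) (h.add (h.mul_left (W * t) e1) (h.mul_left (W₂ * s) e2))
    refine h.trans (h.conv e3 (by ring) rfl) (h.conv h3 (by ring) ?_)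
    rw [pow_mul, pow_right_comm a (N' + 1)]
    ring

theorem total_of_maximal {a : R} {θ : ℝ} (hθ : 0 ≤ θ)
    (hmax : Maximal (fun P : R → R → Prop => IsStrassenPreorder P ∧ Admissible a θ P) le)
    (u v : R) : le u v ∨ le v u := by
  have h := hmax.1.1
  have key : ∀ u v : R, ¬ le u v → ∃ c t : R, le (c + 1 + t * v) (c + t * u) := by
    intro u v huv
    have h1 : ¬ Admissible a θ (adjoin le u v) := fun h' => huv (adjoin_of_maximal hmax h')
    simp only [Admissible] at h1
    push Not at h1
    obtain ⟨c, s, n, M, hM, hn, t, ht⟩ := h1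
    have h2 := h.mul_left s (pow_le_of_maximal hθ hmax hM hn)
    exact ⟨c + s * n, t, h.trans (h.conv ht (by ring) rfl)
      (h.conv (h.add_left (c + t * u) h2) (by ring) (by ring))⟩
  by_contra hcon
  push Not at hcon
  obtain ⟨c, t, h1⟩ := key u v hcon.1
  obtain ⟨c', t', h2⟩ := key v u hcon.2
  rcases h.one_le t with rfl | ht
  · exact hmax.1.2.nondegenerate c (by simpa using h1)
  · refine h.not_add_le_self (fun n => hmax.1.2.nondegenerate (n : R)) (w := t + t')
      (c := t' * c + t * c' + t * t' * u + t * t' * v) (h.trans ht (h.le_add_right _ _)) ?_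
    exact h.conv (h.add (h.mul_left t' h1) (h.mul_left t h2)) (by ring) (by ring)

/-- The real number that a total preorder assigns to `x`: the infimum of all fractions `p / q`
with `q x ≤ p`. -/
noncomputable def value (le : R → R → Prop) (x : R) : ℝ :=
  sInf {r | ∃ p q : ℕ, 0 < q ∧ r = p / q ∧ le (q * x) p}

theorem value_set_bddBelow (x : R) :
    BddBelow {r : ℝ | ∃ p q : ℕ, 0 < q ∧ r = p / q ∧ le (q * x) p} := by
  refine ⟨0, ?_⟩
  rintro _ ⟨p, q, -, rfl, -⟩
  positivity

theorem value_le {x : R} {p q : ℕ} (hq : 0 < q) (hle : le (q * x) p) : value le x ≤ p / q :=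
  csInf_le (value_set_bddBelow x) ⟨p, q, hq, rfl, hle⟩

theorem exists_of_value_lt (h : IsStrassenPreorder le) {x : R} {t : ℝ} (ht : value le x < t) :
    ∃ p q : ℕ, 0 < q ∧ (p / q : ℝ) < t ∧ le (q * x) p := by
  obtain ⟨n, hn⟩ := h.le_nat x
  have hne : {r : ℝ | ∃ p q : ℕ, 0 < q ∧ r = p / q ∧ le (q * x) p}.Nonempty :=
    ⟨_, n, 1, one_pos, rfl, by simpa using hn⟩
  obtain ⟨_, ⟨p, q, hq, rfl, hle⟩, hlt⟩ := exists_lt_of_csInf_lt hne ht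
  exact ⟨p, q, hq, hlt, hle⟩

theorem value_nonneg (x : R) : 0 ≤ value le x := by
  refine Real.sInf_nonneg ?_
  rintro _ ⟨p, q, -, rfl, -⟩
  positivity

theorem natCast_le_natCast (h : IsStrassenPreorder le) (hnd : ∀ n : ℕ, ¬ le (n + 1 : R) n)
    {m n : ℕ} (hmn : le (m : R) n) : m ≤ n := by
  by_contra hlt
  refine hnd n (h.trans ?_ hmn)
  rw [← Nat.cast_succ]
  exact h.natCast (by omega)

theorem le_value (h : IsStrassenPreorder le) (hnd : ∀ n : ℕ, ¬ le (n + 1 : R) n) {x : R}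
    {p q : ℕ} (hq : 0 < q) (hle : le (p : R) (q * x)) : (p / q : ℝ) ≤ value le x := by
  refine le_of_forall_gt fun t ht => ?_
  obtain ⟨p', q', hq', hlt, hle'⟩ := h.exists_of_value_lt ht
  refine lt_of_le_of_lt ?_ hlt
  rw [div_le_div_iff₀ (by positivity) (by positivity)]
  have := h.natCast_le_natCast hnd (m := p * q') (n := p' * q) (by
    push_cast
    exact h.trans (h.mul_right (q' : R) hle) (h.conv (h.mul_right (q : R) hle') (by ring) rfl))
  exact_mod_cast this

theorem exists_of_lt_value (htot : ∀ x y, le x y ∨ le y x) {x : R} {t : ℝ}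
    (ht : t < value le x) (ht0 : 0 ≤ t) :
    ∃ p q : ℕ, 0 < q ∧ t < (p / q : ℝ) ∧ le (p : R) (q * x) := by
  obtain ⟨r, hr1, hr2⟩ := exists_rat_btwn ht
  have hr0 : 0 ≤ r := by exact_mod_cast ht0.trans hr1.le
  have hr : (r.num.toNat / r.den : ℝ) = r := by
    have : (r.num.toNat : ℤ) = r.num := Int.toNat_of_nonneg (Rat.num_nonneg.2 hr0)
    rw [← Int.cast_natCast (R := ℝ) r.num.toNat, this]
    exact (Rat.cast_def r).symm
  refine ⟨r.num.toNat, r.den, r.den_pos, by rwa [hr], ?_⟩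
  refine (htot _ _).resolve_left fun hle => ?_
  have := value_le r.den_pos hle
  rw [hr] at this
  exact absurd hr2 this.not_gt

theorem value_natCast (h : IsStrassenPreorder le) (hnd : ∀ n : ℕ, ¬ le (n + 1 : R) n) (n : ℕ) :
    value le (n : R) = n := by
  refine le_antisymm ?_ ?_
  · simpa using value_le (le := le) (x := (n : R)) (p := n) one_pos (by simpa using h.refl _)
  · simpa using h.le_value hnd (x := (n : R)) (p := n) one_pos (by simpa using h.refl _)

theorem value_mono (h : IsStrassenPreorder le) {x y : R} (hxy : le x y) :
    value le x ≤ value le y := by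
  refine le_of_forall_gt fun t ht => ?_
  obtain ⟨p, q, hq, hlt, hle⟩ := h.exists_of_value_lt ht
  exact (value_le hq (h.trans (h.mul_left _ hxy) hle)).trans_lt hlt

theorem value_add (h : IsStrassenPreorder le) (hnd : ∀ n : ℕ, ¬ le (n + 1 : R) n)
    (htot : ∀ x y, le x y ∨ le y x) (x y : R) :
    value le (x + y) = value le x + value le y := by
  refine le_antisymm ?_ ?_
  · refine le_of_forall_pos_le_add fun ε hε => ?_
    obtain ⟨p, q, hq, hlt, hle⟩ := h.exists_of_value_lt (lt_add_of_pos_right (value le x)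
        (half_pos hε))
    obtain ⟨p', q', hq', hlt', hle'⟩ :=
      h.exists_of_value_lt (lt_add_of_pos_right (value le y) (half_pos hε))
    have h1 := value_le (le := le) (x := x + y) (p := p * q' + p' * q) (Nat.mul_pos hq hq') (by
      push_cast
      exact h.conv (h.add (h.mul_right (q' : R) hle) (h.mul_right (q : R) hle')) (by ring) rfl)
    refine h1.trans ?_
    have h2 : ((p * q' + p' * q : ℕ) / (q * q' : ℕ) : ℝ) = p / q + p' / q' := by
      push_cast
      field_simp
    rw [h2]
    linarith
  · refine le_of_forall_pos_le_add fun ε hε => ?_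
    have key : ∀ z : R, ∃ p q : ℕ, 0 < q ∧ value le z - ε / 2 ≤ (p / q : ℝ) ∧ le (p : R) (q * z)
        := by
      intro z
      by_cases hz : 0 ≤ value le z - ε / 2
      · obtain ⟨p, q, hq, hlt, hle⟩ := exists_of_lt_value htot (sub_lt_self (value le z)
            (half_pos hε)) hz
        exact ⟨p, q, hq, hlt.le, hle⟩
      · exact ⟨0, 1, one_pos, by simpa using (not_le.1 hz).le, by simpa using h.zero_le z⟩
    obtain ⟨p, q, hq, hlt, hle⟩ := key x
    obtain ⟨p', q', hq', hlt', hle'⟩ := key y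
    have h1 := h.le_value hnd (x := x + y) (p := p * q' + p' * q) (Nat.mul_pos hq hq') (by
      push_cast
      exact h.conv (h.add (h.mul_right (q' : R) hle) (h.mul_right (q : R) hle')) rfl (by ring))
    have h2 : ((p * q' + p' * q : ℕ) / (q * q' : ℕ) : ℝ) = p / q + p' / q' := by
      push_cast
      field_simp
    rw [h2] at h1
    linarith

theorem value_mul (h : IsStrassenPreorder le) (hnd : ∀ n : ℕ, ¬ le (n + 1 : R) n)
    (htot : ∀ x y, le x y ∨ le y x) (x y : R) :
    value le (x * y) = value le x * value le y := by
  refine le_antisymm ?_ ?_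
  · refine le_mul_of_forall_lt₀ fun s hs t ht => ?_
    obtain ⟨p, q, hq, hlt, hle⟩ := h.exists_of_value_lt hs
    obtain ⟨p', q', hq', hlt', hle'⟩ := h.exists_of_value_lt ht
    have h1 := value_le (le := le) (x := x * y) (p := p * p') (Nat.mul_pos hq hq') (by
      push_cast
      exact h.conv (h.mul hle hle') (by ring) rfl)
    refine h1.trans ?_
    push_cast
    rw [mul_div_mul_comm]
    exact mul_le_mul hlt.le hlt'.le (by positivity) ((by positivity : (0 : ℝ) ≤ p / q).trans hlt.le)
  · refine mul_le_of_forall_lt_of_nonneg (value_nonneg x) (value_nonneg _) fun s hs0 hs t ht0 ht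
        => ?_
    obtain ⟨p, q, hq, hlt, hle⟩ := exists_of_lt_value htot hs hs0
    obtain ⟨p', q', hq', hlt', hle'⟩ := exists_of_lt_value htot ht ht0
    have h1 := h.le_value hnd (x := x * y) (p := p * p') (Nat.mul_pos hq hq') (by
      push_cast
      exact h.conv (h.mul hle hle') rfl (by ring))
    refine le_trans ?_ h1
    push_cast
    rw [mul_div_mul_comm]
    exact mul_le_mul hlt.le hlt'.le ht0 (by positivity)

/-- The monotone homomorphism to the nonnegative reals given by a total preorder. -/
noncomputable def valueHom (h : IsStrassenPreorder le) (hnd : ∀ n : ℕ, ¬ le (n + 1 : R) n)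
    (htot : ∀ x y, le x y ∨ le y x) : R →+* ℝ≥0 where
  toFun x := ⟨value le x, value_nonneg x⟩
  map_zero' := NNReal.eq ((congrArg _ Nat.cast_zero).symm.trans
    ((h.value_natCast hnd 0).trans Nat.cast_zero))
  map_one' := NNReal.eq ((congrArg _ Nat.cast_one).symm.trans
    ((h.value_natCast hnd 1).trans Nat.cast_one))
  map_add' x y := NNReal.eq (h.value_add hnd htot x y)
  map_mul' x y := NNReal.eq (h.value_mul hnd htot x y)

theorem le_of_forall_pow_le {x y C : ℝ} (hy : 0 ≤ y)
    (hxy : ∀ j : ℕ, x ^ j ≤ C * y ^ j) : x ≤ y := by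
  by_contra! hlt
  rcases hy.eq_or_lt with rfl | hy
  · have := hxy 1
    simp only [pow_one, mul_zero] at this
    linarith
  · obtain ⟨j, hj⟩ := pow_unbounded_of_one_lt C ((one_lt_div hy).2 hlt)
    rw [div_pow, lt_div_iff₀ (by positivity)] at hj
    exact (hxy j).not_gt hj

theorem admissible_of_two_le (h : IsStrassenPreorder le) {a : R} (ha : le 2 a) {θ : ℝ}
    (hθ : ∀ k N : ℕ, le (k : R) (a ^ N) → (k : ℝ) ≤ θ ^ N) (hθ0 : 0 ≤ θ) :
    Admissible a θ le := by
  intro c s n M _ hn hle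
  have hn0 : 1 ≤ n := by
    have : (0 : ℝ) < n := (pow_nonneg hθ0 M).trans_lt hn
    exact_mod_cast this
  have ha1 : le 1 a := h.trans (by simpa using h.natCast (n := 1) (m := 2) (by norm_num)) ha
  have hpow : ∀ k : ℕ, ∃ e, le (k : R) (a ^ e) := fun k =>
    ⟨k, h.trans (h.natCast (Nat.lt_two_pow_self (n := k)).le) (by simpa using h.pow ha k)⟩
  obtain ⟨S, hS⟩ := h.le_nat s
  obtain ⟨d, hd⟩ := hpow (S + 1)
  have key : ∀ N : ℕ, (n : ℝ) ^ N ≤ θ ^ (d + M * (N + 1)) := by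
    intro N
    obtain ⟨c', W, hW, h1⟩ := h.amplify (x := 0) (y := 0) (by simpa using hle) N
    simp only [mul_zero, add_zero] at h1
    obtain ⟨K, hK⟩ := h.le_nat c'
    obtain ⟨e, he⟩ := hpow (K + 1)
    set u := a ^ M with hu
    have hu1 : le 1 (u ^ (N + 1)) := h.one_le_pow (h.one_le_pow ha1 M) _
    have h2 : le (((K + 1 : ℕ) : R) * n ^ N) ((K + 1 : ℕ) * ((S + 1 : ℕ) * u ^ (N + 1))) := by
      have h3 := h.nsmul_add_le (w := W) (c := c') (d := s * u ^ (N + 1))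
        (h.trans (h.conv (h.le_add_right (W + c') (s * n ^ (N + 1))) rfl (by ring)) h1) (K + 1)
      refine h.trans (h.mul_left _ hW) (h.trans (h.le_add_right _ _) (h.trans h3 ?_))
      have h4 : le c' ((K + 1 : ℕ) * u ^ (N + 1)) :=
        h.trans hK (h.trans (h.natCast (Nat.le_succ K)) (h.conv (h.mul_left _ hu1) (mul_one
            _).symm rfl))
      refine h.conv (h.add h4 (h.mul_left ((K + 1 : ℕ) : R) (h.mul_right (u ^ (N + 1)) hS))) rfl ?_
      push_cast
      ring
    have h5 : ∀ j : ℕ, le (((K + 1 : ℕ) : R) * (n ^ N) ^ j)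
        ((K + 1 : ℕ) * ((S + 1 : ℕ) * u ^ (N + 1)) ^ j) := by
      intro j
      induction j with
      | zero => simpa using h.refl _
      | succ j ih =>
        refine h.trans (h.conv (h.mul_right ((n : R) ^ N) ih) (by ring) rfl) ?_
        exact h.conv (h.mul_right (((S + 1 : ℕ) * u ^ (N + 1)) ^ j) h2) (by ring) (by ring)
    refine le_of_forall_pow_le (by positivity) (C := θ ^ e) fun j => ?_
    have h6 : le ((((n ^ N) ^ j : ℕ)) : R) (a ^ (e + (d + M * (N + 1)) * j)) := by
      have h7 : le ((((n ^ N) ^ j : ℕ)) : R) ((K + 1 : ℕ) * (n ^ N) ^ j) := by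
        push_cast
        exact h.conv (h.le_add_left _ ((K : R) * (n ^ N) ^ j)) rfl (by ring)
      refine h.trans h7 (h.trans (h5 j) ?_)
      refine h.conv (h.mul he (h.pow (h.mul_right (u ^ (N + 1)) hd) j)) rfl ?_
      rw [hu]
      ring
    have h8 := hθ _ _ h6
    push_cast at h8
    rw [pow_add, pow_mul] at h8
    exact h8
  refine absurd (le_of_forall_pow_le (by positivity) (C := θ ^ (d + M)) fun N => ?_)
    hn.not_ge
  refine (key N).trans (le_of_eq ?_)
  rw [← pow_mul, ← pow_add]
  ring

theorem admissible_of_le_one (h : IsStrassenPreorder le) (hnd : ∀ n : ℕ, ¬ le (n + 1 : R) n)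
    {a : R} (ha1 : le a 1) {θ : ℝ} (hθ0 : 0 ≤ θ) : Admissible a θ le := by
  intro c s n M hM hn hle
  have hn0 : 1 ≤ n := by
    have : (0 : ℝ) < n := (pow_nonneg hθ0 M).trans_lt hn
    exact_mod_cast this
  have hs : le (s * a ^ M) (s * n) := by
    refine h.mul_left s (h.trans (h.pow ha1 M) ?_)
    rw [one_pow]
    simpa using h.natCast hn0
  have := h.trans hle (h.add_left c hs)
  exact h.not_add_le_self hnd (w := 1) (c := c + s * n) (h.refl 1)
    (h.conv this (by ring) rfl)

/-- Spectral points with small value at `a`, for elements that are at most `1` or at least `2`. -/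
theorem exists_hom_le (h : IsStrassenPreorder le) (hnd : ∀ n : ℕ, ¬ le (n + 1 : R) n) {a : R}
    (ha : le a 1 ∨ le 2 a) {θ : ℝ} (hθ0 : 0 ≤ θ)
    (hθ : ∀ k N : ℕ, le (k : R) (a ^ N) → (k : ℝ) ≤ θ ^ N) :
    ∃ φ : R →+* ℝ≥0, (∀ x y, le x y → φ x ≤ φ y) ∧ (φ a : ℝ) ≤ θ := by
  have hadm : Admissible a θ le := by
    rcases ha with ha | ha
    · exact h.admissible_of_le_one hnd ha hθ0
    · exact h.admissible_of_two_le ha hθ hθ0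
  obtain ⟨P, hleP, hmax⟩ := h.exists_maximal hadm
  have hP := hmax.1.1
  have hndP : ∀ n : ℕ, ¬ P (n + 1 : R) n := fun n => hmax.1.2.nondegenerate _
  refine ⟨hP.valueHom hndP (total_of_maximal hθ0 hmax), fun x y hxy => ?_, ?_⟩
  · exact hP.value_mono (hleP x y hxy)
  · set φ := hP.valueHom hndP (total_of_maximal hθ0 hmax)
    have hmono : ∀ x y, P x y → φ x ≤ φ y := fun x y hxy => hP.value_mono hxy
    have hbound : ∀ M : ℕ, 1 ≤ M → (φ a : ℝ) ^ M ≤ θ ^ M + 1 := by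
      intro M hM
      have h1 := hmono _ _ (pow_le_of_maximal hθ0 hmax hM
        (n := ⌊θ ^ M⌋₊ + 1) (by push_cast; exact Nat.lt_floor_add_one _))
      have h2 : (φ a : ℝ) ^ M ≤ ((⌊θ ^ M⌋₊ + 1 : ℕ) : ℝ) := by
        rw [map_pow, map_natCast] at h1
        exact_mod_cast h1
      refine h2.trans ?_
      push_cast
      linarith [Nat.floor_le (pow_nonneg hθ0 M)]
    rcases h.one_le a with ha0 | ha1
    · simpa [ha0] using hθ0
    · have hθ1 : 1 ≤ θ := by simpa using hθ 1 1 (by simpa using ha1)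
      refine le_of_forall_pow_le hθ0 (C := 2) fun M => ?_
      have := one_le_pow₀ hθ1 (n := M)
      rcases Nat.eq_zero_or_pos M with rfl | hM
      · norm_num
      · linarith [hbound M hM]

end IsStrassenPreorder

namespace NCGraph

/-- The map `G ↦ Tr_α ((1 ⊗ ρ) G)`. -/
def weightedTrace {ι α : Type} [Fintype α] (ρ : Matrix α α ℂ) :
    Matrix (ι × α) (ι × α) ℂ →ₗ[ℂ] Matrix ι ι ℂ where
  toFun G := Matrix.of fun b a => ∑ x, ∑ y, ρ x y * G (b, y) (a, x)
  map_add' G H := by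
    ext b a
    simp [mul_add, Finset.sum_add_distrib]
  map_smul' c G := by
    ext b a
    simp [mul_left_comm _ c, Finset.mul_sum]

theorem weightedTrace_apply {ι α : Type} [Fintype α] (ρ : Matrix α α ℂ)
    (G : Matrix (ι × α) (ι × α) ℂ) (b a : ι) :
    weightedTrace ρ G b a = ∑ x, ∑ y, ρ x y * G (b, y) (a, x) := rfl

theorem trace_kronecker_mul {ι α : Type} [Fintype ι] [Fintype α] (X : Matrix ι ι ℂ)
    (ρ : Matrix α α ℂ) (G : Matrix (ι × α) (ι × α) ℂ) :
    ((X ⊗ₖ ρ) * G).trace = (X * weightedTrace ρ G).trace := by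
  simp only [Matrix.trace, Matrix.diag, Matrix.mul_apply, Fintype.sum_prod_type,
    weightedTrace_apply, Matrix.kronecker_apply, Finset.mul_sum]
  refine Finset.sum_congr rfl fun a _ => ?_
  rw [Finset.sum_comm]
  refine Finset.sum_congr rfl fun b _ => ?_
  refine Finset.sum_congr rfl fun x _ => ?_
  refine Finset.sum_congr rfl fun y _ => ?_
  ring

theorem trace_conjTranspose_sandwich {ι α τ : Type} [Fintype ι] [Fintype α] [Fintype τ]
    {ρ : Matrix α α ℂ} (hρ : ρ.IsHermitian) (X : Matrix ι ι ℂ) (E F : Matrix τ (ι × α) ℂ)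
    (Y : Matrix τ τ ℂ) :
    ((E * (X ⊗ₖ ρ) * Fᴴ)ᴴ * Y).trace = (Xᴴ * weightedTrace ρ (Eᴴ * Y * F)).trace := by
  rw [← trace_kronecker_mul]
  simp only [Matrix.conjTranspose_mul, Matrix.conjTranspose_conjTranspose,
    Matrix.conjTranspose_kronecker, hρ.eq]
  rw [Matrix.mul_assoc, Matrix.trace_mul_comm]
  simp only [Matrix.mul_assoc]

/-- The double orthogonal complement of `S` is `S`. -/
theorem mem_space_of_forall_orthTo {S : NCGraph} {M : Matrix S.ι S.ι ℂ}
    (h : ∀ X, S.OrthTo X → (Xᴴ * M).trace = 0) : M ∈ S.space := by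
  by_contra hM
  obtain ⟨f, hf, hfS⟩ := Submodule.exists_le_ker_of_notMem hM
  have key : ∀ N : Matrix S.ι S.ι ℂ,
      ((Matrix.of fun a b => star (f (Matrix.single a b 1)) : Matrix S.ι S.ι ℂ)ᴴ * N).trace
        = f N := by
    intro N
    conv_rhs => rw [Matrix.matrix_eq_sum_single N, map_sum]
    simp only [Matrix.trace, Matrix.diag, Matrix.mul_apply, Matrix.conjTranspose_apply,
      Matrix.of_apply, star_star, map_sum]
    rw [Finset.sum_comm]
    refine Finset.sum_congr rfl fun a _ => Finset.sum_congr rfl fun b _ => ?_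
    have : Matrix.single a b (N a b) = N a b • Matrix.single a b (1 : ℂ) := by simp
    rw [this, map_smul, smul_eq_mul, mul_comm]
  refine hf ?_
  rw [← key]
  refine h _ fun Y hY => ?_
  rw [HSOrth, key]
  exact hfS hY

/-- The dual form of the cohomomorphism preorder, in which the adjoint maps carry `T` into `S`. -/
theorem eale_of_forall_weightedTrace_mem {S T : NCGraph} {α : Type} [Fintype α] [DecidableEq α]
    {ρ : Matrix α α ℂ} (E : QChannel (S.ι × α) T.ι) (hρ : ρ.PosDef) (htr : ρ.trace = 1)
    (h : ∀ Y ∈ T.space, ∀ i j, weightedTrace ρ ((E.kraus i)ᴴ * Y * E.kraus j) ∈ S.space) :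
    EALE S T := by
  refine ⟨α, _, _, ρ, E, hρ, htr, fun X hX i j Y hY => ?_⟩
  rw [HSOrth, trace_conjTranspose_sandwich hρ.isHermitian]
  exact hX _ (h Y hY i j)

theorem EALE.exists_weightedTrace_mem {S T : NCGraph} (h : EALE S T) :
    ∃ (α : Type) (_ : Fintype α) (_ : DecidableEq α) (ρ : Matrix α α ℂ)
      (E : QChannel (S.ι × α) T.ι), ρ.PosDef ∧ ρ.trace = 1 ∧
      ∀ Y ∈ T.space, ∀ i j, weightedTrace ρ ((E.kraus i)ᴴ * Y * E.kraus j) ∈ S.space := by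
  obtain ⟨α, _, _, ρ, E, hρ, htr, h⟩ := h
  refine ⟨α, _, _, ρ, E, hρ, htr, fun Y hY i j => mem_space_of_forall_orthTo fun X hX => ?_⟩
  rw [← trace_conjTranspose_sandwich hρ.isHermitian]
  exact h X hX i j Y hY

theorem weightedTrace_mem_of_mem_span {ι α τ : Type} [Fintype τ] [Fintype α]
    {ρ : Matrix α α ℂ} {A B : Matrix τ (ι × α) ℂ} {V : Submodule ℂ (Matrix ι ι ℂ)}
    {s : Set (Matrix τ τ ℂ)} (h : ∀ Y ∈ s, weightedTrace ρ (Aᴴ * Y * B) ∈ V) :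
    ∀ Y ∈ Submodule.span ℂ s, weightedTrace ρ (Aᴴ * Y * B) ∈ V := by
  intro Y hY
  induction hY using Submodule.span_induction with
  | mem x hx => exact h x hx
  | zero => simp
  | add x y _ _ hx hy =>
    rw [Matrix.mul_add, Matrix.add_mul, map_add]
    exact V.add_mem hx hy
  | smul c x _ hx =>
    rw [Matrix.mul_smul, Matrix.smul_mul, map_smul]
    exact V.smul_mem c hx

theorem kronecker_one_sandwich {ι τ β : Type} [Fintype τ] [Fintype β] [DecidableEq β]
    (A B : Matrix τ ι ℂ) (Y : Matrix τ τ ℂ) (Z : Matrix β β ℂ) :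
    (A ⊗ₖ (1 : Matrix β β ℂ) : Matrix (τ × β) (ι × β) ℂ).conjTranspose *
      (Y ⊗ₖ Z : Matrix (τ × β) (τ × β) ℂ) * (B ⊗ₖ (1 : Matrix β β ℂ) : Matrix (τ × β) (ι × β) ℂ) =
    (Aᴴ * Y * B) ⊗ₖ Z := by
  rw [Matrix.conjTranspose_kronecker, ← Matrix.mul_kronecker_mul, ← Matrix.mul_kronecker_mul,
    Matrix.conjTranspose_one, Matrix.one_mul, Matrix.mul_one]

theorem kronecker_sandwich_one {ι τ τ' β : Type} [Fintype ι] [Fintype β] [DecidableEq β]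
    (A : Matrix τ ι ℂ) (M : Matrix ι ι ℂ) (B : Matrix ι τ' ℂ) (Z : Matrix β β ℂ) :
    (A * M * B) ⊗ₖ Z = (A ⊗ₖ (1 : Matrix β β ℂ) : Matrix (τ × β) (ι × β) ℂ) *
      (M ⊗ₖ Z : Matrix (ι × β) (ι × β) ℂ) * (B ⊗ₖ (1 : Matrix β β ℂ) : Matrix (ι × β) (τ' × β) ℂ)
          := by
  rw [← Matrix.mul_kronecker_mul, ← Matrix.mul_kronecker_mul, Matrix.one_mul, Matrix.mul_one]

theorem EALE.trans {S T R : NCGraph} (h₁ : EALE S T) (h₂ : EALE T R) : EALE S R := by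
  obtain ⟨α, _, _, ρ, E, hρ, hρtr, hE⟩ := h₁
  obtain ⟨β, _, _, σ, F, hσ, hσtr, hF⟩ := h₂
  have key : ∀ (j : F.κ) (L : Matrix (T.ι × β) ((S.ι × α) × β) ℂ),
      (F.kraus j * L)ᴴ * (F.kraus j * L) = Lᴴ * ((F.kraus j)ᴴ * F.kraus j) * L := by
    intro j L
    simp only [Matrix.conjTranspose_mul, Matrix.mul_assoc]
  refine ⟨α × β, _, _, ρ ⊗ₖ σ,
    { κ := E.κ × F.κ
      kraus := fun p => (F.kraus p.2 * (E.kraus p.1 ⊗ₖ (1 : Matrix β β ℂ))).submatrix id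
        (Equiv.prodAssoc _ _ _).symm
      sum_eq_one := ?_ }, hρ.kronecker hσ, by rw [Matrix.trace_kronecker, hρtr, hσtr, one_mul],
    fun X hX p q => ?_⟩
  · simp only [Matrix.conjTranspose_submatrix, Matrix.submatrix_mul _ _ _ id _
        Function.bijective_id |>.symm, key]
    rw [Fintype.sum_prod_type]
    have h1 : ∀ i : E.κ, ∑ j : F.κ, ((E.kraus i ⊗ₖ (1 : Matrix β β ℂ) :
        Matrix (T.ι × β) ((S.ι × α) × β) ℂ).conjTranspose * ((F.kraus j)ᴴ * F.kraus j) *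
        (E.kraus i ⊗ₖ (1 : Matrix β β ℂ) : Matrix (T.ι × β) ((S.ι × α) × β) ℂ)) =
        ((E.kraus i)ᴴ * E.kraus i) ⊗ₖ 1 := by
      intro i
      rw [← Matrix.sum_mul, ← Matrix.mul_sum, F.sum_eq_one, ← Matrix.one_kronecker_one,
        kronecker_one_sandwich, Matrix.mul_one]
    have h2 : ∑ i : E.κ, ((E.kraus i)ᴴ * E.kraus i) ⊗ₖ (1 : Matrix β β ℂ) = 1 := by
      have : ∑ i : E.κ, ((E.kraus i)ᴴ * E.kraus i) ⊗ₖ (1 : Matrix β β ℂ) =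
          (∑ i : E.κ, ((E.kraus i)ᴴ * E.kraus i)) ⊗ₖ (1 : Matrix β β ℂ) := by
        ext ⟨a, b⟩ ⟨c, d⟩
        simp [Matrix.sum_apply, Finset.sum_mul]
      rw [this, E.sum_eq_one, Matrix.one_kronecker_one]
    ext a b
    have h3 := congrFun (congrFun h2 ((Equiv.prodAssoc S.ι α β).symm a))
      ((Equiv.prodAssoc S.ι α β).symm b)
    simp only [← h1, Matrix.sum_apply, Matrix.submatrix_apply] at h3 ⊢
    rw [h3]
    simp [Matrix.one_apply, Prod.ext_iff, and_assoc]
  · have h1 := hF _ (hE X hX p.1 q.1) p.2 q.2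
    convert h1 using 1
    have h2 : X ⊗ₖ (ρ ⊗ₖ σ) = ((X ⊗ₖ ρ) ⊗ₖ σ).submatrix (Equiv.prodAssoc _ _ _).symm
        (Equiv.prodAssoc _ _ _).symm := by
      rw [← Matrix.kronecker_assoc]
      rfl
    rw [h2, Matrix.conjTranspose_submatrix, Matrix.submatrix_mul_equiv,
      Matrix.submatrix_mul_equiv, Matrix.submatrix_id_id, Matrix.conjTranspose_mul,
      Matrix.conjTranspose_kronecker, Matrix.conjTranspose_one]
    rw [kronecker_sandwich_one]
    simp only [Matrix.mul_assoc]

theorem Iso.eale {S T : NCGraph} (h : Iso S T) : EALE S T := by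
  obtain ⟨U, h1, h2, h3⟩ := h
  refine eale_of_forall_weightedTrace_mem (α := Unit) (ρ := 1)
    { κ := Unit, kraus := fun _ => Uᴴ.submatrix id Prod.fst, sum_eq_one := ?_ }
    Matrix.PosDef.one (by simp) fun Y hY _ _ => ?_
  · rw [Finset.univ_unique, Finset.sum_singleton, Matrix.conjTranspose_submatrix,
      ← Matrix.submatrix_mul _ _ _ id _ Function.bijective_id,
          Matrix.conjTranspose_conjTranspose, h1]
    ext ⟨a, _⟩ ⟨b, _⟩
    simp [Matrix.one_apply]
  · rw [← SetLike.mem_coe, h3] at hY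
    obtain ⟨X, hX, rfl⟩ := hY
    have h4 : U * (Uᴴ * X * U) * Uᴴ = X := by
      calc U * (Uᴴ * X * U) * Uᴴ = (U * Uᴴ) * X * (U * Uᴴ) := by simp only [Matrix.mul_assoc]
        _ = X := by rw [h1, Matrix.one_mul, Matrix.mul_one]
    have h5 : (Uᴴ.submatrix id (Prod.fst : S.ι × Unit → S.ι))ᴴ * (Uᴴ * X * U) *
        Uᴴ.submatrix id (Prod.fst : S.ι × Unit → S.ι) = X.submatrix Prod.fst Prod.fst := by
      rw [show X.submatrix (Prod.fst : S.ι × Unit → S.ι) Prod.fst =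
        (U * (Uᴴ * X * U) * Uᴴ).submatrix Prod.fst Prod.fst by rw [h4],
        Matrix.submatrix_mul _ _ _ id _ Function.bijective_id,
        Matrix.submatrix_mul _ _ _ id _ Function.bijective_id]
      simp
    refine mem_of_eq hX ?_
    refine (congrArg _ h5).trans ?_
    ext b a
    simp [weightedTrace_apply]

theorem EALE.refl (S : NCGraph) : EALE S S := (Iso.refl S).eale

theorem EALE.tensor_right {S T : NCGraph} (h : EALE S T) (R : NCGraph) :
    EALE (S.tensor R) (T.tensor R) := by
  obtain ⟨α, _, _, ρ, E, hρ, htr, h⟩ := h.exists_weightedTrace_mem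
  let e : (S.ι × R.ι) × α ≃ (S.ι × α) × R.ι :=
    ⟨fun p => ((p.1.1, p.2), p.1.2), fun p => ((p.1.1, p.2), p.1.2), fun _ => rfl, fun _ => rfl⟩
  have key : ∀ (A : Matrix T.ι (S.ι × α) ℂ) (B : Matrix T.ι (S.ι × α) ℂ) (Y : Matrix T.ι T.ι ℂ)
      (Z : Matrix R.ι R.ι ℂ),
      ((A ⊗ₖ (1 : Matrix R.ι R.ι ℂ)).submatrix id e)ᴴ * (Y ⊗ₖ Z) *
        (B ⊗ₖ (1 : Matrix R.ι R.ι ℂ)).submatrix id e = ((Aᴴ * Y * B) ⊗ₖ Z).submatrix e e := by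
    intro A B Y Z
    rw [← kronecker_one_sandwich]
    rfl
  refine eale_of_forall_weightedTrace_mem (ρ := ρ)
    { κ := E.κ, kraus := fun i => (E.kraus i ⊗ₖ (1 : Matrix R.ι R.ι ℂ)).submatrix id e,
      sum_eq_one := ?_ } hρ htr fun Y hY i j => ?_
  · have h1 : ∀ i, ((E.kraus i ⊗ₖ (1 : Matrix R.ι R.ι ℂ)).submatrix id e)ᴴ *
        (E.kraus i ⊗ₖ (1 : Matrix R.ι R.ι ℂ)).submatrix id e =
        (((E.kraus i)ᴴ * E.kraus i) ⊗ₖ (1 : Matrix R.ι R.ι ℂ)).submatrix e e := by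
      intro i
      simpa using key (E.kraus i) (E.kraus i) 1 1
    refine (Finset.sum_congr rfl fun i _ => h1 i).trans ?_
    have h2 : ∑ i, (((E.kraus i)ᴴ * E.kraus i) ⊗ₖ (1 : Matrix R.ι R.ι ℂ)).submatrix e e =
        ((∑ i, ((E.kraus i)ᴴ * E.kraus i)) ⊗ₖ (1 : Matrix R.ι R.ι ℂ)).submatrix e e := by
      ext a b
      simp [Matrix.sum_apply, Finset.sum_mul]
    rw [h2, E.sum_eq_one, Matrix.one_kronecker_one, Matrix.submatrix_one_equiv]
  · refine weightedTrace_mem_of_mem_span ?_ Y hY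
    rintro _ ⟨Y, hY, Z, hZ, rfl⟩
    refine mem_of_eq (kronecker_mem (h Y hY i j) hZ) ?_
    refine (congrArg _ (key (E.kraus i) (E.kraus j) Y Z)).trans ?_
    ext ⟨b, r⟩ ⟨a, r'⟩
    simp [weightedTrace_apply, e, Finset.sum_mul, mul_assoc]

theorem EALE.directSum_right {S T : NCGraph} (h : EALE S T) (R : NCGraph) :
    EALE (S.directSum R) (T.directSum R) := by
  obtain ⟨α, _, _, ρ, E, hρ, htr, h⟩ := h.exists_weightedTrace_mem
  let e := Equiv.sumProdDistrib S.ι R.ι α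
  let G : α → Matrix R.ι (R.ι × α) ℂ := fun x => Matrix.of fun r p => if p = (r, x) then 1 else 0
  have hG : ∀ (x y : α) (Z : Matrix R.ι R.ι ℂ) (p q : R.ι × α),
      ((G x)ᴴ * Z * G y) p q = if p.2 = x ∧ q.2 = y then Z p.1 q.1 else 0 := by
    rintro x y Z ⟨r, x'⟩ ⟨r', y'⟩
    by_cases hx : x' = x <;> by_cases hy : y' = y <;>
      simp [G, Matrix.mul_apply, Prod.ext_iff, hx, hy]
  let K : E.κ ⊕ α → Matrix (T.ι ⊕ R.ι) (S.ι × α ⊕ R.ι × α) ℂ :=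
    Sum.elim (fun i => Matrix.fromBlocks (E.kraus i) 0 0 0) fun x => Matrix.fromBlocks 0 0 0 (G x)
  have hK : ∀ k l (M : Matrix (T.ι ⊕ R.ι) (T.ι ⊕ R.ι) ℂ),
      ((K k).submatrix id e)ᴴ * M * (K l).submatrix id e = ((K k)ᴴ * M * K l).submatrix e e :=
    fun _ _ _ => rfl
  have hw : ∀ (A : Matrix (S.ι × α) (S.ι × α) ℂ) (D : Matrix (R.ι × α) (R.ι × α) ℂ),
      weightedTrace ρ ((Matrix.fromBlocks A 0 0 D).submatrix e e) =
        Matrix.fromBlocks (weightedTrace ρ A) 0 0 (weightedTrace ρ D) := by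
    intro A D
    ext (b | b) (a | a) <;> simp [weightedTrace_apply, e]
  refine eale_of_forall_weightedTrace_mem (ρ := ρ)
    { κ := E.κ ⊕ α, kraus := fun k => (K k).submatrix id e, sum_eq_one := ?_ } hρ htr ?_
  · have h1 : ∀ k, ((K k).submatrix id e)ᴴ * (K k).submatrix id e =
        ((K k)ᴴ * K k).submatrix e e := fun _ => rfl
    refine (Finset.sum_congr rfl fun i _ => h1 i).trans ?_
    have h2 : ∑ k, (K k)ᴴ * K k = 1 := by
      have h3 : ∑ x, (G x)ᴴ * G x = 1 := by
        ext ⟨r, x⟩ ⟨r', x'⟩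
        have := fun y => hG y y 1 (r, x) (r', x')
        simp only [Matrix.mul_one] at this
        simp only [Matrix.sum_apply, this]
        by_cases hx : x = x'
        · subst hx
          simp [Matrix.one_apply]
        · rw [Finset.sum_eq_zero fun y _ => if_neg fun hy => hx (hy.1.trans hy.2.symm)]
          simp [hx]
      have h4 := E.sum_eq_one
      rw [← Matrix.fromBlocks_one, ← h3, ← h4, Fintype.sum_sum_type]
      ext (a | a) (b | b) <;>
        simp [K, Matrix.sum_apply, Matrix.fromBlocks_conjTranspose, Matrix.fromBlocks_multiply]
    have h5 : ∑ k, ((K k)ᴴ * K k).submatrix e e = (∑ k, (K k)ᴴ * K k).submatrix e e := by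
      ext a b
      simp [Matrix.sum_apply]
    rw [h5, h2, Matrix.submatrix_one_equiv]
  · rintro _ ⟨Y, hY, Z, hZ, rfl⟩ k l
    refine mem_of_eq (Y := weightedTrace ρ (((K k)ᴴ * Matrix.fromBlocks Y 0 0 Z * K l).submatrix
        e e))
      ?_ rfl
    rcases k with i | x <;> rcases l with j | y
    · simp only [K, Sum.elim_inl, Matrix.fromBlocks_conjTranspose, Matrix.fromBlocks_multiply,
        Matrix.conjTranspose_zero, Matrix.mul_zero, Matrix.zero_mul, add_zero, hw]
      exact ⟨_, h Y hY i j, _, Submodule.zero_mem _, by rw [map_zero]⟩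
    · simp only [K, Sum.elim_inl, Sum.elim_inr, Matrix.fromBlocks_conjTranspose,
          Matrix.fromBlocks_multiply,
        Matrix.conjTranspose_zero, Matrix.mul_zero, Matrix.zero_mul, add_zero, hw]
      exact ⟨_, Submodule.zero_mem _, _, Submodule.zero_mem _, by simp⟩
    · simp only [K, Sum.elim_inl, Sum.elim_inr, Matrix.fromBlocks_conjTranspose,
          Matrix.fromBlocks_multiply,
        Matrix.conjTranspose_zero, Matrix.mul_zero, Matrix.zero_mul, add_zero, hw]
      exact ⟨_, Submodule.zero_mem _, _, Submodule.zero_mem _, by simp⟩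
    · simp only [K, Sum.elim_inr, Matrix.fromBlocks_conjTranspose, Matrix.fromBlocks_multiply,
        Matrix.conjTranspose_zero, Matrix.mul_zero, Matrix.zero_mul, add_zero, zero_add, hw]
      refine ⟨_, Submodule.zero_mem _, _, R.space.smul_mem (ρ y x) hZ, ?_⟩
      rw [map_zero]
      congr 1
      ext b a
      simp only [weightedTrace_apply, hG, Matrix.smul_apply, smul_eq_mul]
      rw [Finset.sum_eq_single y, Finset.sum_eq_single x] <;> simp +contextual

end NCGraph

namespace NCGraph

theorem kbar_orthTo_iff {n : ℕ} {X : Matrix (Fin n) (Fin n) ℂ} :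
    (kbar n).OrthTo X ↔ ∀ i, X i i = 0 := by
  have key : ∀ i, (Xᴴ * Matrix.single i i (1 : ℂ)).trace = star (X i i) := by
    intro i
    rw [Matrix.trace_mul_single]
    simp
  constructor
  · intro h i
    have := h _ (Submodule.subset_span ⟨i, rfl⟩)
    rw [HSOrth, key] at this
    simpa using this
  · intro h Y hY
    rw [HSOrth]
    induction hY using Submodule.span_induction with
    | mem x hx => obtain ⟨i, rfl⟩ := hx; simp [key, h]
    | zero => simp
    | add x y _ _ hx hy => rw [Matrix.mul_add, Matrix.trace_add, hx, hy, add_zero]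
    | smul c x _ hx => rw [Matrix.mul_smul, Matrix.trace_smul, hx, smul_zero]

theorem orthTo_zero (S : NCGraph) : S.OrthTo 0 := fun Y _ => by simp [HSOrth]

theorem OrthTo.smul {S : NCGraph} {X : Matrix S.ι S.ι ℂ} (h : S.OrthTo X) (c : ℂ) :
    S.OrthTo (c • X) := fun Y hY => by
  rw [HSOrth, Matrix.conjTranspose_smul, Matrix.smul_mul, Matrix.trace_smul,
    show (Xᴴ * Y).trace = 0 from h Y hY, smul_zero]

theorem OrthTo.add {S : NCGraph} {X Z : Matrix S.ι S.ι ℂ} (h : S.OrthTo X) (h' : S.OrthTo Z) :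
    S.OrthTo (X + Z) := fun Y hY => by
  rw [HSOrth, Matrix.conjTranspose_add, Matrix.add_mul, Matrix.trace_add,
    show (Xᴴ * Y).trace = 0 from h Y hY, show (Zᴴ * Y).trace = 0 from h' Y hY, add_zero]

theorem OrthTo.conjTranspose {S : NCGraph} {X : Matrix S.ι S.ι ℂ} (h : S.OrthTo X) :
    S.OrthTo Xᴴ := fun Y hY => by
  have h1 : (Xᴴ * Yᴴ).trace = 0 := h _ (S.conjTranspose_mem Y hY)
  rw [HSOrth, Matrix.conjTranspose_conjTranspose, Matrix.trace_mul_comm]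
  rw [← Matrix.conjTranspose_mul, Matrix.trace_conjTranspose] at h1
  simpa using h1

theorem eale_of_orthTo_eq_zero {S T : NCGraph} (E : QChannel (S.ι × Unit) T.ι)
    (h : ∀ X, S.OrthTo X → X = 0) : EALE S T := by
  refine ⟨Unit, _, _, 1, E, Matrix.PosDef.one, by simp, fun X hX i j => ?_⟩
  rw [h X hX, Matrix.zero_kronecker, Matrix.mul_zero, Matrix.zero_mul]
  exact T.orthTo_zero

theorem kbar_zero_eale (S : NCGraph) : EALE (kbar 0) S := by
  refine eale_of_orthTo_eq_zero (S := kbar 0)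
    { κ := Empty, kraus := fun i => i.elim, sum_eq_one := ?_ } fun X _ => ?_
  · ext ⟨a, _⟩
    exact Fin.elim0 a
  · ext a
    exact Fin.elim0 a

theorem kbar_one_eale (S : NCGraph) [h : Nonempty S.ι] : EALE (kbar 1) S := by
  obtain ⟨t₀⟩ := h
  refine eale_of_orthTo_eq_zero (S := kbar 1)
    { κ := Unit, kraus := fun _ => Matrix.of fun t _ => if t = t₀ then 1 else 0,
      sum_eq_one := ?_ } fun X hX => ?_
  · ext ⟨a, _⟩ ⟨b, _⟩
    rw [Subsingleton.elim (α := Fin 1) a b]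
    simp [Matrix.mul_apply]
  · rw [kbar_orthTo_iff] at hX
    ext a b
    rw [Subsingleton.elim (α := Fin 1) a b]
    exact hX b

theorem eale_kbar_one {S : NCGraph} (h : ∀ X, S.OrthTo X → X = 0) : EALE S (kbar 1) := by
  refine eale_of_orthTo_eq_zero (T := kbar 1)
    { κ := S.ι, kraus := fun s => Matrix.of fun _ p => if p.1 = s then 1 else 0,
      sum_eq_one := ?_ } h
  ext ⟨a, _⟩ ⟨b, _⟩
  simp [Matrix.mul_apply, Matrix.sum_apply, Matrix.one_apply, eq_comm]

theorem mem_kbar_iff {n : ℕ} {X : Matrix (Fin n) (Fin n) ℂ} :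
    X ∈ (kbar n).space ↔ ∀ a b, a ≠ b → X a b = 0 := by
  constructor
  · intro hX a b hab
    induction hX using Submodule.span_induction with
    | mem x hx =>
      obtain ⟨i, rfl⟩ := hx
      exact Matrix.single_apply_of_ne _ _ _ _ _ fun h => hab (h.1.symm.trans h.2)
    | zero => rfl
    | add x y _ _ hx hy => rw [Matrix.add_apply, hx, hy, add_zero]
    | smul c x _ hx => rw [Matrix.smul_apply, hx, smul_zero]
  · intro h
    have hX : X = ∑ i, X i i • Matrix.single i i (1 : ℂ) := by
      ext a b
      rw [Matrix.sum_apply]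
      by_cases hab : a = b
      · subst hab
        simp [Matrix.single_apply]
      · rw [h a b hab, Finset.sum_eq_zero]
        intro i _
        rw [Matrix.smul_apply, Matrix.single_apply_of_ne _ _ _ _ _ fun h => hab (h.1.symm.trans
            h.2),
          smul_zero]
    rw [hX]
    exact Submodule.sum_mem _ fun i _ => Submodule.smul_mem _ _ (Submodule.subset_span ⟨i, rfl⟩)

theorem kbar_succ_iso (n : ℕ) : Iso (kbar (n + 1)) ((kbar n).directSum (kbar 1)) := by
  refine Iso.symm (Iso.of_equiv (S := (kbar n).directSum (kbar 1)) (T := kbar (n + 1))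
    finSumFinEquiv ?_ ?_)
  · rintro _ ⟨X, hX, Y, hY, rfl⟩
    refine mem_kbar_iff.2 fun a b hab => ?_
    obtain ⟨a, rfl⟩ := finSumFinEquiv.surjective a
    obtain ⟨b, rfl⟩ := finSumFinEquiv.surjective b
    simp only [Matrix.submatrix_apply, Equiv.symm_apply_apply]
    rcases a with a | a <;> rcases b with b | b
    · exact mem_kbar_iff.1 hX a b fun h => hab (by rw [h])
    · rfl
    · rfl
    · exact mem_kbar_iff.1 hY a b fun h => hab (by rw [h])
  · intro Z hZ
    rw [mem_kbar_iff] at hZ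
    refine ⟨Matrix.of fun a b => Z (finSumFinEquiv (Sum.inl a)) (finSumFinEquiv (Sum.inl b)),
      mem_kbar_iff.2 fun a b hab => hZ _ _ (by simpa using hab),
      Matrix.of fun a b => Z (finSumFinEquiv (Sum.inr a)) (finSumFinEquiv (Sum.inr b)),
      mem_kbar_iff.2 fun a b hab => hZ _ _ (by simpa using hab), ?_⟩
    ext (a | a) (b | b)
    · rfl
    · exact hZ _ _ (finSumFinEquiv.injective.ne Sum.inl_ne_inr)
    · exact hZ _ _ (finSumFinEquiv.injective.ne Sum.inr_ne_inl)
    · rfl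

theorem mul_kronecker_mul_conjTranspose {ι α τ : Type} [Fintype ι] [Fintype α]
    (A B : Matrix τ (ι × α) ℂ) (X : Matrix ι ι ℂ) (ρ : Matrix α α ℂ) :
    A * (X ⊗ₖ ρ) * Bᴴ = ∑ x, ∑ y, X x y •
      (A.submatrix id (Prod.mk x) * ρ * (B.submatrix id (Prod.mk y))ᴴ) := by
  ext s t
  simp only [Matrix.mul_apply, Matrix.sum_apply, Matrix.smul_apply, Fintype.sum_prod_type,
    Matrix.kronecker_apply, Matrix.submatrix_apply, Matrix.conjTranspose_apply, id, smul_eq_mul,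
    Finset.sum_mul, Finset.mul_sum]
  symm
  rw [Finset.sum_comm]
  refine Finset.sum_congr rfl fun y _ => ?_
  rw [Finset.sum_comm]
  refine Finset.sum_congr rfl fun b _ => Finset.sum_congr rfl fun x _ =>
    Finset.sum_congr rfl fun a _ => ?_
  ring

theorem sum_finrank_le_of_iSupIndep {ι V : Type*} [Fintype ι] [AddCommGroup V] [Module ℂ V]
    [FiniteDimensional ℂ V] {W : ι → Submodule ℂ V} (hW : iSupIndep W) :
    ∑ i, Module.finrank ℂ (W i) ≤ Module.finrank ℂ V := by
  classical
  have key : ∀ s : Finset ι, ∑ i ∈ s, Module.finrank ℂ (W i) = Module.finrank ℂ ↥(s.sup W) := by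
    intro s
    induction s using Finset.induction_on with
    | empty => rw [Finset.sum_empty, Finset.sup_empty, finrank_bot]
    | insert a s ha ih =>
      have h1 : Disjoint (W a) (s.sup W) :=
        hW.supIndep' (insert a s) (Finset.subset_insert a s) (Finset.mem_insert_self a s) ha
      have h2 := Submodule.finrank_sup_add_finrank_inf_eq (W a) (s.sup W)
      rw [h1.eq_bot, finrank_bot, add_zero] at h2
      rw [Finset.sum_insert ha, Finset.sup_insert, h2, ih]
  rw [key]
  exact Submodule.finrank_le _

theorem iSupIndep_of_posDef_orthogonal {α ι : Type*} [Fintype α] {ρ : Matrix α α ℂ}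
    (hρ : ρ.PosDef) {W : ι → Submodule ℂ (α → ℂ)}
    (hW : ∀ i j, i ≠ j → ∀ u ∈ W i, ∀ v ∈ W j, star u ⬝ᵥ (ρ *ᵥ v) = 0) : iSupIndep W := by
  intro i
  rw [Submodule.disjoint_def]
  intro u hu hu'
  by_contra hne
  refine (hρ.dotProduct_mulVec_pos hne).ne' ?_
  let f : (α → ℂ) →ₗ[ℂ] ℂ := (dotProductBilin ℂ ℂ (star u)).comp ρ.mulVecLin
  have hle : ⨆ j, ⨆ (_ : j ≠ i), W j ≤ LinearMap.ker f :=
    iSup₂_le fun j hj v hv => hW i j hj.symm u hu v hv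
  exact hle hu'

theorem le_of_kbar_eale {n m : ℕ} (h : EALE (kbar n) (kbar m)) : n ≤ m := by
  obtain ⟨α, _, _, ρ, E, hρ, htr, h⟩ := h
  have hα : Nonempty α := by
    by_contra hα
    rw [not_nonempty_iff] at hα
    simp [Matrix.trace] at htr
  let w : Fin n → Fin m → E.κ → α → ℂ := fun x z i a => star (E.kraus i z (x, a))
  let W : Fin n → Fin m → Submodule ℂ (α → ℂ) := fun x z => Submodule.span ℂ (Set.range (w x z))
  have horth : ∀ x y z, x ≠ y → ∀ u ∈ W x z, ∀ v ∈ W y z, star u ⬝ᵥ (ρ *ᵥ v) = 0 := by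
    intro x y z hxy u hu v hv
    induction hu using Submodule.span_induction with
    | mem u hu =>
      obtain ⟨i, rfl⟩ := hu
      induction hv using Submodule.span_induction with
      | mem v hv =>
        obtain ⟨j, rfl⟩ := hv
        have h1 := h (Matrix.single x y 1) (kbar_orthTo_iff.2 fun k => by
          simp only [Matrix.single_apply]
          rw [if_neg]
          rintro ⟨rfl, rfl⟩
          exact hxy rfl) i j
        rw [kbar_orthTo_iff] at h1
        rw [← h1 z, mul_kronecker_mul_conjTranspose, Finset.sum_eq_single x, Finset.sum_eq_single y,
          Matrix.single_apply_same, one_smul, Matrix.mul_assoc, Matrix.mul_apply]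
        · refine Finset.sum_congr rfl fun a _ => ?_
          simp [w, Matrix.mulVec, dotProduct, Matrix.mul_apply]
        · intro y' _ hy'
          rw [Matrix.single_apply_of_ne _ _ _ _ _ fun h => hy' h.2.symm, zero_smul]
        · simp
        · intro x' _ hx'
          refine Finset.sum_eq_zero fun y' _ => ?_
          rw [Matrix.single_apply_of_ne _ _ _ _ _ fun h => hx' h.1.symm, zero_smul]
        · simp
      | zero => simp
      | add v v' _ _ hv hv' => rw [Matrix.mulVec_add, dotProduct_add, hv, hv', add_zero]
      | smul c v _ hv => rw [Matrix.mulVec_smul, dotProduct_smul, hv, smul_zero]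
    | zero => simp
    | add u u' _ _ hu hu' => rw [star_add, add_dotProduct, hu, hu', add_zero]
    | smul c u _ hu => rw [star_smul, smul_dotProduct, hu, smul_zero]
  have htop : ∀ x, Module.finrank ℂ (α → ℂ) ≤ ∑ z, Module.finrank ℂ (W x z) := by
    intro x
    have h1 : (⊤ : Submodule ℂ (α → ℂ)) ≤ Finset.univ.sup (W x) := by
      intro v _
      have hv : v = ∑ z, ∑ i, (∑ a, E.kraus i z (x, a) * v a) • w x z i := by
        ext a
        have h1 : ∀ b, ∑ z, ∑ i, star (E.kraus i z (x, a)) * E.kraus i z (x, b) =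
            if a = b then 1 else 0 := by
          intro b
          have h2 := congrFun (congrFun E.sum_eq_one (x, a)) (x, b)
          rw [Finset.sum_comm]
          simpa [Matrix.sum_apply, Matrix.mul_apply, Matrix.one_apply] using h2
        have h2 : v a = ∑ b, (∑ z, ∑ i, star (E.kraus i z (x, a)) * E.kraus i z (x, b)) * v b := by
          simp only [h1]
          simp
        rw [h2]
        simp only [Finset.sum_apply, Pi.smul_apply, smul_eq_mul, w, Finset.sum_mul]
        rw [Finset.sum_comm]
        refine Finset.sum_congr rfl fun z _ => ?_
        rw [Finset.sum_comm]
        refine Finset.sum_congr rfl fun i _ => Finset.sum_congr rfl fun b _ => ?_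
        ring
      rw [hv]
      refine Submodule.sum_mem _ fun z _ => ?_
      refine (Finset.le_sup (f := W x) (Finset.mem_univ z)) ?_
      exact Submodule.sum_mem _ fun i _ => Submodule.smul_mem _ _ (Submodule.subset_span ⟨i, rfl⟩)
    have h2 : ∀ s : Finset (Fin m),
        Module.finrank ℂ ↥(s.sup (W x)) ≤ ∑ z ∈ s, Module.finrank ℂ (W x z) := by
      intro s
      induction s using Finset.induction_on with
      | empty => simp
      | insert a s ha ih =>
        rw [Finset.sum_insert ha, Finset.sup_insert]
        exact (Submodule.finrank_add_le_finrank_add_finrank _ _).trans (by omega)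
    refine le_trans ?_ (h2 Finset.univ)
    rw [top_le_iff.1 h1, finrank_top]
  have hcard : n * Module.finrank ℂ (α → ℂ) ≤ m * Module.finrank ℂ (α → ℂ) := by
    calc n * Module.finrank ℂ (α → ℂ) = ∑ x : Fin n, Module.finrank ℂ (α → ℂ) := by simp
      _ ≤ ∑ x, ∑ z, Module.finrank ℂ (W x z) := Finset.sum_le_sum fun x _ => htop x
      _ = ∑ z, ∑ x, Module.finrank ℂ (W x z) := Finset.sum_comm
      _ ≤ ∑ z : Fin m, Module.finrank ℂ (α → ℂ) := Finset.sum_le_sum fun z _ =>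
          sum_finrank_le_of_iSupIndep (iSupIndep_of_posDef_orthogonal hρ fun x y hxy =>
            horth x y z hxy)
      _ = m * Module.finrank ℂ (α → ℂ) := by simp
  exact Nat.le_of_mul_le_mul_right hcard Module.finrank_pos

end NCGraph

namespace NCGraph

theorem exists_unitary_diagonal {ι : Type} [Fintype ι] [DecidableEq ι] {A : Matrix ι ι ℂ}
    (hA : A.IsHermitian) : ∃ (U : Matrix ι ι ℂ) (d : ι → ℝ), Uᴴ * U = 1 ∧ U * Uᴴ = 1 ∧
      A = U * Matrix.diagonal (fun i => (d i : ℂ)) * Uᴴ := by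
  refine ⟨hA.eigenvectorUnitary, hA.eigenvalues, ?_, ?_, ?_⟩
  · exact Unitary.coe_star_mul_self hA.eigenvectorUnitary
  · exact Unitary.coe_mul_star_self hA.eigenvectorUnitary
  · conv_lhs => rw [hA.spectral_theorem]
    rfl

theorem diagonal_eq_of_eq_unitary {ι : Type} [Fintype ι] [DecidableEq ι] {A U : Matrix ι ι ℂ}
    {d : ι → ℂ} (hU : Uᴴ * U = 1) (hA : A = U * Matrix.diagonal d * Uᴴ) :
    Uᴴ * A * U = Matrix.diagonal d := by
  rw [hA]
  calc Uᴴ * (U * Matrix.diagonal d * Uᴴ) * U = (Uᴴ * U) * Matrix.diagonal d * (Uᴴ * U) := by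
        simp only [Matrix.mul_assoc]
    _ = Matrix.diagonal d := by rw [hU, Matrix.one_mul, Matrix.mul_one]

/-- A positive semidefinite matrix is a positive definite one on its support. -/
theorem exists_isometry_posDef {ι : Type} [Fintype ι] [DecidableEq ι] {A : Matrix ι ι ℂ}
    (hA : A.PosSemidef) : ∃ (κ : Type) (_ : Fintype κ) (_ : DecidableEq κ) (V : Matrix ι κ ℂ)
      (ρ : Matrix κ κ ℂ), Vᴴ * V = 1 ∧ ρ.PosDef ∧ A = V * ρ * Vᴴ := by
  obtain ⟨U, d, hU, -, hAU⟩ := exists_unitary_diagonal hA.isHermitian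
  have hd : ∀ i, 0 ≤ d i := by
    intro i
    have h1 := (hA.conjTranspose_mul_mul_same U).diag_nonneg (i := i)
    rw [diagonal_eq_of_eq_unitary hU hAU, Matrix.diagonal_apply_eq] at h1
    exact_mod_cast h1
  refine ⟨{i // d i ≠ 0}, inferInstance, inferInstance, U.submatrix id Subtype.val,
    Matrix.diagonal fun i => (d i : ℂ), ?_, ?_, ?_⟩
  · rw [Matrix.conjTranspose_submatrix, ← Matrix.submatrix_mul _ _ _ id _ Function.bijective_id, hU]
    exact Matrix.submatrix_one _ Subtype.val_injective
  · rw [Matrix.posDef_diagonal_iff]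
    intro i
    exact_mod_cast (hd i).lt_of_ne' i.2
  · rw [hAU]
    ext a b
    rw [Matrix.mul_apply, Matrix.mul_apply]
    simp only [Matrix.mul_diagonal, Matrix.submatrix_apply, id, Matrix.conjTranspose_apply]
    rw [← Finset.sum_subtype (Finset.univ.filter fun i => d i ≠ 0) (by simp)
      fun i => U a i * (d i : ℂ) * star (U b i), Finset.sum_filter_of_ne]
    intro i _ hi h0
    exact hi (by simp [h0])

theorem reducedState_eq {α β : Type} [Fintype β] (Ω : α × β → ℂ) :
    reducedState Ω = (Matrix.of fun a b => Ω (a, b)) * (Matrix.of fun a b => Ω (a, b))ᴴ := by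
  ext a b
  simp [reducedState, Matrix.mul_apply]

theorem trace_reducedState {α β : Type} [Fintype α] [Fintype β] (Ω : α × β → ℂ) :
    (reducedState Ω).trace = ((∑ x, ‖Ω x‖ ^ 2 : ℝ) : ℂ) := by
  simp only [Matrix.trace, Matrix.diag, reducedState, Matrix.of_apply, Fintype.sum_prod_type]
  push_cast
  refine Finset.sum_congr rfl fun a _ => Finset.sum_congr rfl fun b _ => ?_
  exact Complex.mul_conj' _

/-- Entanglement-assisted independent sets of size `k` are cohomomorphisms from `kbar k`. -/
theorem hasEAIndependentSet_iff {S : NCGraph} {k : ℕ} :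
    S.HasEAIndependentSet k ↔ EALE (kbar k) S := by
  constructor
  · rintro ⟨α, β, _, _, _, Ω, E, hΩ, hE⟩
    have hpsd : (reducedState Ω).PosSemidef := by
      rw [reducedState_eq]
      exact Matrix.posSemidef_self_mul_conjTranspose _
    obtain ⟨κ, _, _, V, ρ, hV, hρ, hVρ⟩ := exists_isometry_posDef hpsd
    have hEV : ∀ x, ∑ l, ((E x).kraus l * V)ᴴ * ((E x).kraus l * V) = 1 := by
      intro x
      have h1 : ∀ l, ((E x).kraus l * V)ᴴ * ((E x).kraus l * V) =
          Vᴴ * (((E x).kraus l)ᴴ * (E x).kraus l) * V := fun l => by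
        simp only [Matrix.conjTranspose_mul, Matrix.mul_assoc]
      simp only [h1]
      rw [← Matrix.sum_mul, ← Matrix.mul_sum, (E x).sum_eq_one, Matrix.mul_one, hV]
    let K : (Σ x, (E x).κ) → Matrix S.ι (Fin k × κ) ℂ := fun i => Matrix.of fun s p =>
      if p.1 = i.1 then ((E i.1).kraus i.2 * V) s p.2 else 0
    have hK : ∀ i y, (K i).submatrix id (Prod.mk y) =
        if y = i.1 then (E i.1).kraus i.2 * V else 0 := by
      intro i y
      ext s a
      by_cases h : y = i.1 <;> simp [K, h]
    refine ⟨κ, _, _, ρ, ⟨Σ x, (E x).κ, K, ?_⟩, hρ, ?_, fun X hX i j => ?_⟩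
    · ext ⟨x, a⟩ ⟨y, b⟩
      simp only [Matrix.sum_apply, Fintype.sum_sigma, Matrix.mul_apply, Matrix.conjTranspose_apply,
        K, Matrix.of_apply]
      have h1 := congrFun (congrFun (hEV x) a) b
      simp only [Matrix.sum_apply, Matrix.mul_apply, Matrix.conjTranspose_apply] at h1
      by_cases hxy : x = y
      · subst hxy
        rw [Finset.sum_eq_single x]
        · simp only [if_true, h1]
          simp [Matrix.one_apply]
        · intro z _ hz
          simp [hz.symm]
        · simp
      · rw [Finset.sum_eq_zero, Matrix.one_apply_ne (by simp [hxy])]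
        intro z _
        refine Finset.sum_eq_zero fun l _ => Finset.sum_eq_zero fun s _ => ?_
        by_cases hz : x = z
        · subst hz
          simp [Ne.symm hxy]
        · simp [hz]
    · have h1 := trace_reducedState Ω
      rw [hΩ, hVρ, Matrix.trace_mul_comm, ← Matrix.mul_assoc, hV, Matrix.one_mul] at h1
      simpa using h1
    · rw [kbar_orthTo_iff] at hX
      rw [mul_kronecker_mul_conjTranspose, Finset.sum_eq_single i.1, Finset.sum_eq_single j.1]
      · simp only [hK, if_true]
        by_cases hij : i.1 = j.1
        · rw [(congrArg (fun z => X z j.1) hij).trans (hX j.1), zero_smul]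
          exact S.orthTo_zero
        · have h1 := hE i.1 j.1 hij i.2 j.2
          rw [hVρ] at h1
          convert h1.smul (X i.1 j.1) using 2
          simp only [Matrix.conjTranspose_mul, Matrix.mul_assoc]
      · intro y _ hy
        simp [hK, hy]
      · simp
      · intro x _ hx
        simp [hK, hx]
      · simp
  · rintro ⟨α, _, _, ρ, E, hρ, htr, hE⟩
    obtain ⟨U, d, hU, hU', hρU⟩ := exists_unitary_diagonal hρ.isHermitian
    have hd : ∀ i, 0 ≤ d i := by
      intro i
      have h1 := (hρ.posSemidef.conjTranspose_mul_mul_same U).diag_nonneg (i := i)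
      rw [diagonal_eq_of_eq_unitary hU hρU, Matrix.diagonal_apply_eq] at h1
      exact_mod_cast h1
    let C : Matrix α α ℂ := U * Matrix.diagonal fun i => ((Real.sqrt (d i) : ℝ) : ℂ)
    have hC : reducedState (fun p : α × α => C p.1 p.2) = ρ := by
      rw [reducedState_eq]
      change C * Cᴴ = ρ
      simp only [C, Matrix.conjTranspose_mul, Matrix.diagonal_conjTranspose]
      rw [hρU, Matrix.mul_assoc, ← Matrix.mul_assoc (Matrix.diagonal _),
          Matrix.diagonal_mul_diagonal,
        ← Matrix.mul_assoc]
      congr 3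
      ext i
      simp only [Pi.star_apply, Complex.star_def, Complex.conj_ofReal]
      rw [← Complex.ofReal_mul, Real.mul_self_sqrt (hd i)]
    refine ⟨α, α, inferInstance, inferInstance, inferInstance, fun p => C p.1 p.2, fun x =>
      ⟨E.κ, fun l => (E.kraus l).submatrix id (Prod.mk x), ?_⟩, ?_, ?_⟩
    · ext a b
      have h1 := congrFun (congrFun E.sum_eq_one (x, a)) (x, b)
      simpa [Matrix.sum_apply, Matrix.mul_apply, Matrix.one_apply] using h1
    · have h1 := trace_reducedState fun p : α × α => C p.1 p.2
      rw [hC, htr] at h1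
      exact_mod_cast h1.symm
    · intro x y hxy l l'
      have h1 := hE (Matrix.single x y 1) (kbar_orthTo_iff.2 fun i =>
        Matrix.single_apply_of_ne _ _ _ _ _ fun h => hxy (h.1.trans h.2.symm)) l l'
      rw [mul_kronecker_mul_conjTranspose, Finset.sum_eq_single x, Finset.sum_eq_single y,
        Matrix.single_apply_same, one_smul] at h1
      · rw [hC]
        exact h1
      · intro y' _ hy'
        rw [Matrix.single_apply_of_ne _ _ _ _ _ fun h => hy' h.2.symm, zero_smul]
      · simp
      · intro x' _ hx'
        refine Finset.sum_eq_zero fun y' _ => ?_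
        rw [Matrix.single_apply_of_ne _ _ _ _ _ fun h => hx' h.1.symm, zero_smul]
      · simp

theorem exists_isHermitian_orthTo {S : NCGraph} {X : Matrix S.ι S.ι ℂ} (hX : S.OrthTo X)
    (hne : X ≠ 0) : ∃ Z, S.OrthTo Z ∧ Z.IsHermitian ∧ Z ≠ 0 := by
  by_cases h : X + Xᴴ = 0
  · refine ⟨Complex.I • X, hX.smul _, ?_, by simpa using hne⟩
    rw [Matrix.IsHermitian, Matrix.conjTranspose_smul, eq_neg_of_add_eq_zero_right h]
    simp
  · refine ⟨X + Xᴴ, hX.add hX.conjTranspose, ?_, h⟩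
    rw [Matrix.IsHermitian, Matrix.conjTranspose_add, Matrix.conjTranspose_conjTranspose, add_comm]

/-- A nonzero element of the orthogonal complement gives an independent set of size two: the
channels are two unitaries from the polar decomposition of a Hermitian element. -/
theorem kbar_two_eale {S : NCGraph} {X : Matrix S.ι S.ι ℂ} (hX : S.OrthTo X) (hne : X ≠ 0) :
    EALE (kbar 2) S := by
  rw [← hasEAIndependentSet_iff]
  obtain ⟨Z, hZ, hherm, hZ0⟩ := exists_isHermitian_orthTo hX hne
  obtain ⟨U, d, hU, hU', hZU⟩ := exists_unitary_diagonal hherm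
  set t : ℝ := ∑ i, |d i| with ht
  have ht0 : 0 < t := by
    refine (Finset.sum_nonneg fun i _ => abs_nonneg (d i)).lt_of_ne' fun h0 => hZ0 ?_
    rw [Finset.sum_eq_zero_iff_of_nonneg fun i _ => abs_nonneg (d i)] at h0
    have : (fun i => (d i : ℂ)) = 0 := by
      ext i
      simpa using h0 i (Finset.mem_univ i)
    rw [hZU, this]
    simp
  let σ : S.ι → ℂ := fun i => if d i < 0 then -1 else 1
  have hσ : ∀ i, σ i * |d i| = d i ∧ star (σ i) = σ i ∧ σ i * σ i = 1 := by
    intro i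
    by_cases h : d i < 0
    · simp [σ, h, abs_of_neg h]
    · simp [σ, h, abs_of_nonneg (not_lt.1 h)]
  let ρ : Matrix S.ι S.ι ℂ := Matrix.diagonal fun i => ((|d i| / t : ℝ) : ℂ)
  let Ω : S.ι × S.ι → ℂ := fun p => if p.1 = p.2 then ((Real.sqrt (|d p.1| / t) : ℝ) : ℂ) else 0
  have hΩ : reducedState Ω = ρ := by
    ext a b
    simp only [reducedState, Matrix.of_apply, Ω, ρ]
    by_cases hab : a = b
    · subst hab
      rw [Finset.sum_eq_single a]
      · simp only [if_true, Matrix.diagonal_apply_eq, Complex.star_def, Complex.conj_ofReal]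
        rw [← Complex.ofReal_mul, Real.mul_self_sqrt (by positivity)]
      · intro c _ hc
        simp [hc.symm]
      · simp
    · rw [Matrix.diagonal_apply_ne _ hab, Finset.sum_eq_zero]
      intro c _
      by_cases hac : a = c
      · subst hac
        simp [Ne.symm hab]
      · simp [hac]
  have hZt : ((t⁻¹ : ℝ) : ℂ) • Z = U * Matrix.diagonal (fun i => σ i * ((|d i| / t : ℝ) : ℂ)) *
      Uᴴ := by
    rw [hZU, ← Matrix.smul_mul, ← Matrix.mul_smul, ← Matrix.diagonal_smul]
    congr 3
    ext i
    simp only [Pi.smul_apply, smul_eq_mul]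
    rw [← (hσ i).1]
    push_cast
    ring
  have hort := hZ.smul ((t⁻¹ : ℝ) : ℂ)
  rw [hZt] at hort
  let K : Fin 2 → Matrix S.ι S.ι ℂ := ![U * Matrix.diagonal σ, U]
  have hstarσ : star σ = σ := funext fun i => (hσ i).2.1
  refine ⟨S.ι, S.ι, inferInstance, inferInstance, inferInstance, Ω,
    fun i => ⟨Unit, fun _ => K i, ?_⟩, ?_, ?_⟩
  · rw [Finset.univ_unique, Finset.sum_singleton]
    fin_cases i
    · change (U * Matrix.diagonal σ)ᴴ * (U * Matrix.diagonal σ) = 1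
      rw [Matrix.conjTranspose_mul, Matrix.diagonal_conjTranspose, hstarσ, Matrix.mul_assoc,
        ← Matrix.mul_assoc Uᴴ, hU, Matrix.one_mul, Matrix.diagonal_mul_diagonal]
      simp only [fun i => (hσ i).2.2]
      exact Matrix.diagonal_one
    · exact hU
  · have h1 := trace_reducedState Ω
    rw [hΩ] at h1
    have h2 : ρ.trace = ((∑ i, |d i| / t : ℝ) : ℂ) := by
      simp [ρ, Matrix.trace_diagonal]
    rw [h2, ← Finset.sum_div, ← ht, div_self ht0.ne'] at h1
    exact_mod_cast h1.symm
  · rw [hΩ]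
    intro i j hij _ _
    fin_cases i <;> fin_cases j
    · exact absurd rfl hij
    · change S.OrthTo (U * Matrix.diagonal σ * ρ * Uᴴ)
      rw [Matrix.mul_assoc U, Matrix.diagonal_mul_diagonal]
      exact hort
    · change S.OrthTo (U * ρ * (U * Matrix.diagonal σ)ᴴ)
      rw [Matrix.conjTranspose_mul, Matrix.diagonal_conjTranspose, hstarσ, Matrix.mul_assoc U,
        ← Matrix.mul_assoc ρ, Matrix.diagonal_mul_diagonal, ← Matrix.mul_assoc]
      simp only [mul_comm _ (σ _)]
      exact hort
    · exact absurd rfl hij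

theorem iso_kbar_zero (S : NCGraph) [hS : IsEmpty S.ι] : Iso S (kbar 0) := by
  refine Iso.of_equiv (T := kbar 0) (Equiv.equivOfIsEmpty S.ι (Fin 0)) ?_ ?_
  · exact fun X _ => mem_kbar_iff.2 fun a => a.elim0
  · intro Y _
    refine mem_of_eq S.space.zero_mem ?_
    ext a
    exact hS.elim a

/-- Superdense coding: measuring in a maximally entangled basis. -/
theorem exists_eale_kbar (S : NCGraph) : ∃ n : ℕ, EALE S (kbar n) := by
  rcases isEmpty_or_nonempty S.ι with hS | hS
  · exact ⟨0, S.iso_kbar_zero.eale⟩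
  set d := Fintype.card S.ι with hd
  have : NeZero d := ⟨Fintype.card_ne_zero⟩
  let e : S.ι ≃ ZMod d := Fintype.equivOfCardEq (by rw [ZMod.card])
  let M := AddChar (ZMod d) ℂ × ZMod d
  let g : Fin (Fintype.card M) ≃ M := (Fintype.equivFin M).symm
  let v : M → S.ι × ZMod d → ℂ := fun m p =>
    if p.2 = e p.1 + m.2 then m.1 (e p.1) else 0
  have hd0 : (d : ℂ) ≠ 0 := NeZero.ne _
  have hchar : ∀ (ψ : AddChar (ZMod d) ℂ) (x y : ZMod d), star (ψ x) * ψ y = ψ (y - x) := by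
    intro ψ x y
    rw [Complex.star_def, ← AddChar.inv_apply_eq_conj, AddChar.map_sub_eq_div, div_eq_inv_mul]
  have hdr : 0 < (d : ℝ) := by exact_mod_cast NeZero.pos d
  have hsqrt : ((Real.sqrt d : ℝ) : ℂ)⁻¹ * ((Real.sqrt d : ℝ) : ℂ)⁻¹ = (d : ℂ)⁻¹ := by
    rw [← mul_inv, ← Complex.ofReal_mul, Real.mul_self_sqrt hdr.le]
    simp
  have hv : ∀ p q, ∑ m, star (v m p) * v m q = if p = q then (d : ℂ) else 0 := by
    rintro ⟨k, l⟩ ⟨k', l'⟩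
    have h1 : ∀ c : ZMod d, ∑ ψ : AddChar (ZMod d) ℂ, star (v (ψ, c) (k, l)) * v (ψ, c) (k', l') =
        if c = l - e k then (if (k, l) = (k', l') then (d : ℂ) else 0) else 0 := by
      intro c
      by_cases hl : l = e k + c
      · have hc : c = l - e k := by rw [hl]; ring
        rw [if_pos hc]
        by_cases hl' : l' = e k' + c
        · simp only [v, if_pos hl, if_pos hl', hchar]
          rw [AddChar.sum_apply_eq_ite, ZMod.card]
          congr 1
          rw [sub_eq_zero, e.apply_eq_iff_eq, Prod.mk.injEq, hl, hl', eq_iff_iff]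
          constructor
          · rintro rfl
            exact ⟨rfl, rfl⟩
          · exact fun h => h.1.symm
        · simp only [v, if_neg hl', mul_zero, Finset.sum_const_zero]
          rw [if_neg]
          rintro ⟨rfl, rfl⟩
          exact hl' hl
      · have hc : c ≠ l - e k := by
          rintro rfl
          exact hl (by ring)
        simp [v, hl, hc]
    rw [Fintype.sum_prod_type_right]
    simp only [h1]
    simp
  refine ⟨Fintype.card M, eale_of_forall_weightedTrace_mem (T := kbar (Fintype.card M))
    (ρ := (d : ℂ)⁻¹ • (1 : Matrix (ZMod d) (ZMod d) ℂ))
    ⟨Fin (Fintype.card M), fun m => Matrix.of fun t p =>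
      if t = m then ((Real.sqrt d : ℝ) : ℂ)⁻¹ * v (g m) p else 0, ?_⟩ ?_ ?_ ?_⟩
  · ext p q
    have h1 : ∀ m, ((Matrix.of fun t p => if t = m then ((Real.sqrt d : ℝ) : ℂ)⁻¹ * v (g m) p
        else 0 :
        Matrix (Fin (Fintype.card M)) (S.ι × ZMod d) ℂ)ᴴ * (Matrix.of fun t p =>
        if t = m then ((Real.sqrt d : ℝ) : ℂ)⁻¹ * v (g m) p else 0)) p q =
        (d : ℂ)⁻¹ * (star (v (g m) p) * v (g m) q) := by
      intro m
      rw [Matrix.mul_apply, Finset.sum_eq_single m]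
      · rw [← hsqrt]
        simp only [Matrix.conjTranspose_apply, Matrix.of_apply, if_true, star_mul', star_inv₀,
          Complex.star_def, Complex.conj_ofReal]
        ring
      · intro t _ ht
        simp [ht]
      · simp
    rw [Matrix.sum_apply]
    refine (Finset.sum_congr rfl fun m _ => h1 m).trans ?_
    rw [← Finset.mul_sum, g.sum_comp fun m => star (v m p) * v m q, hv, Matrix.one_apply]
    by_cases hpq : p = q <;> simp [hpq, hd0]
  · refine Matrix.PosDef.one.smul ?_
    have : 0 < ((d : ℝ)⁻¹) := by positivity
    have h := Complex.zero_lt_real.2 this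
    rwa [Complex.ofReal_inv, Complex.ofReal_natCast] at h
  · simp [hd0]
  · intro Y hY i j
    refine mem_of_eq (S.space.smul_mem
      (if i = j then (d : ℂ)⁻¹ * ((d : ℂ)⁻¹ * Y i i) else 0) S.one_mem) ?_
    have h1 : ∀ p q, ((Matrix.of fun t p => if t = i then ((Real.sqrt d : ℝ) : ℂ)⁻¹ * v (g i) p
        else 0 :
        Matrix (Fin (Fintype.card M)) (S.ι × ZMod d) ℂ)ᴴ * Y * (Matrix.of fun t p =>
        if t = j then ((Real.sqrt d : ℝ) : ℂ)⁻¹ * v (g j) p else 0)) p q =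
        (d : ℂ)⁻¹ * Y i j * (star (v (g i) p) * v (g j) q) := by
      intro p q
      rw [Matrix.mul_apply, Finset.sum_eq_single j, Matrix.mul_apply, Finset.sum_eq_single i]
      · simp only [Matrix.conjTranspose_apply, Matrix.of_apply, if_true, star_mul', star_inv₀,
          Complex.star_def, Complex.conj_ofReal]
        linear_combination (Y i j * (starRingEnd ℂ (v (g i) p) * v (g j) q)) * hsqrt
      · intro t _ ht
        simp [ht]
      · simp
      · intro t _ ht
        simp [ht]
      · simp
    by_cases hij : i = j
    · subst hij
      ext b a
      rw [weightedTrace_apply]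
      simp only [h1, if_true]
      have h2 : ∀ x : ZMod d, star (v (g i) (b, x)) * v (g i) (a, x) =
          if x = e b + (g i).2 then (if b = a then 1 else 0) else 0 := by
        intro x
        by_cases hx : x = e b + (g i).2
        · by_cases hab : b = a
          · subst hab
            simp only [v, if_pos hx, hchar, sub_self, if_true, AddChar.map_zero_eq_one]
          · have : x ≠ e a + (g i).2 := fun h => hab (e.injective (add_right_cancel
                (hx.symm.trans h)))
            simp [v, this, hab]
        · simp [v, hx]
      have h3 : ∀ x, ∑ y, ((d : ℂ)⁻¹ • (1 : Matrix (ZMod d) (ZMod d) ℂ)) x y *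
          ((d : ℂ)⁻¹ * Y i i * (star (v (g i) (b, y)) * v (g i) (a, x))) =
          (d : ℂ)⁻¹ * ((d : ℂ)⁻¹ * Y i i * (star (v (g i) (b, x)) * v (g i) (a, x))) := by
        intro x
        rw [Finset.sum_eq_single x]
        · simp
        · intro y _ hy
          simp [Matrix.one_apply_ne hy.symm]
        · simp
      simp only [h3, h2, ← Finset.mul_sum]
      simp [Matrix.one_apply]
    · rw [if_neg hij, zero_smul]
      ext b a
      rw [weightedTrace_apply]
      simp only [h1]
      simp [mem_kbar_iff.1 hY i j hij]

end NCGraph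

namespace NCGraphClass

/-- The entanglement-assisted cohomomorphism preorder on isomorphism classes. -/
def EALE : NCGraphClass → NCGraphClass → Prop :=
  Quotient.lift₂ NCGraph.EALE fun _ _ _ _ h h' => propext
    ⟨fun hle => (h.symm.eale.trans hle).trans h'.eale,
      fun hle => (h.eale.trans hle).trans h'.symm.eale⟩

theorem natCast_eq (n : ℕ) : (n : NCGraphClass) = (NCGraph.kbar n).toClass := by
  induction n with
  | zero => exact Nat.cast_zero
  | succ n ih =>
    rw [Nat.cast_succ, ih]
    exact (Quotient.sound (NCGraph.kbar_succ_iso n)).symm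

theorem isStrassenPreorder_eale : IsStrassenPreorder EALE where
  refl := by
    rintro ⟨S⟩
    exact NCGraph.EALE.refl S
  trans := by
    rintro ⟨S⟩ ⟨T⟩ ⟨R⟩ h h'
    exact NCGraph.EALE.trans h h'
  add_right := by
    rintro ⟨S⟩ ⟨T⟩ ⟨R⟩ h
    exact NCGraph.EALE.directSum_right h R
  mul_right := by
    rintro ⟨S⟩ ⟨T⟩ ⟨R⟩ h
    exact NCGraph.EALE.tensor_right h R
  zero_le_one := NCGraph.kbar_zero_eale (NCGraph.kbar 1)
  one_le := by
    rintro ⟨S⟩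
    rcases isEmpty_or_nonempty S.ι with h | h
    · exact Or.inl (Quotient.sound (NCGraph.iso_kbar_zero S))
    · exact Or.inr (NCGraph.kbar_one_eale S)
  le_nat := by
    rintro ⟨S⟩
    obtain ⟨n, hn⟩ := NCGraph.exists_eale_kbar S
    refine ⟨n, ?_⟩
    rw [natCast_eq]
    exact hn

theorem not_succ_eale (n : ℕ) : ¬ EALE (n + 1) n := by
  rw [← Nat.cast_succ, natCast_eq, natCast_eq]
  exact fun h => Nat.not_succ_le_self n (NCGraph.le_of_kbar_eale h)

end NCGraphClass

namespace NCGraph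

theorem toClass_tensorPow (S : NCGraph) (N : ℕ) : (S.tensorPow N).toClass = S.toClass ^ N := by
  induction N with
  | zero => exact (pow_zero _).symm
  | succ N ih =>
    rw [pow_succ, ← ih]
    rfl

theorem isGreatest_alphaStar (S : NCGraph) :
    IsGreatest {k | S.HasEAIndependentSet k} S.alphaStar := by
  obtain ⟨n, hn⟩ := exists_eale_kbar S
  have hbdd : BddAbove {k | S.HasEAIndependentSet k} :=
    ⟨n, fun k hk => le_of_kbar_eale ((hasEAIndependentSet_iff.1 hk).trans hn)⟩
  exact ⟨Nat.sSup_mem ⟨0, hasEAIndependentSet_iff.2 (kbar_zero_eale S)⟩ hbdd,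
    fun k hk => le_csSup hbdd hk⟩

theorem natCast_eale_toClass_iff {S : NCGraph} {k : ℕ} :
    NCGraphClass.EALE k S.toClass ↔ k ≤ S.alphaStar := by
  have h := NCGraphClass.isStrassenPreorder_eale
  have hiff : ∀ j : ℕ, NCGraphClass.EALE j S.toClass ↔ S.HasEAIndependentSet j := by
    intro j
    rw [hasEAIndependentSet_iff, NCGraphClass.natCast_eq]
    rfl
  exact ⟨fun hk => S.isGreatest_alphaStar.2 ((hiff k).1 hk), fun hk =>
    h.trans (h.natCast hk) ((hiff _).2 S.isGreatest_alphaStar.1)⟩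

theorem alphaStar_tensorPow_mul_le (S : NCGraph) (N M : ℕ) :
    (S.tensorPow N).alphaStar * (S.tensorPow M).alphaStar ≤ (S.tensorPow (N + M)).alphaStar := by
  rw [← natCast_eale_toClass_iff, toClass_tensorPow, pow_add, ← toClass_tensorPow,
    ← toClass_tensorPow, Nat.cast_mul]
  exact NCGraphClass.isStrassenPreorder_eale.mul (natCast_eale_toClass_iff.2 le_rfl)
    (natCast_eale_toClass_iff.2 le_rfl)

theorem alphaStar_tensorPow_zero (S : NCGraph) : (S.tensorPow 0).alphaStar = 1 := by
  refine le_antisymm ?_ (natCast_eale_toClass_iff.1 ?_)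
  · exact le_of_kbar_eale (hasEAIndependentSet_iff.1 (S.tensorPow 0).isGreatest_alphaStar.1)
  · rw [NCGraphClass.natCast_eq]
    exact NCGraphClass.isStrassenPreorder_eale.refl _

/-- Fekete's lemma for the entanglement-assisted independence number. -/
theorem exists_tendsto_alphaStar (S : NCGraph) : ∃ θ : ℝ, 0 ≤ θ ∧
    Tendsto (fun N : ℕ => ((S.tensorPow N).alphaStar : ℝ) ^ (1 / (N : ℝ))) atTop (𝓝 θ) ∧
    ∀ N, ((S.tensorPow N).alphaStar : ℝ) ≤ θ ^ N := by
  have h := NCGraphClass.isStrassenPreorder_eale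
  rcases h.one_le S.toClass with h0 | h1
  · have hα : ∀ N : ℕ, 1 ≤ N → (S.tensorPow N).alphaStar = 0 := by
      intro N hN
      have h2 : NCGraphClass.EALE (S.tensorPow N).alphaStar (S.tensorPow N).toClass :=
        natCast_eale_toClass_iff.2 le_rfl
      rw [toClass_tensorPow, h0, zero_pow (by omega), ← Nat.cast_zero] at h2
      exact Nat.le_zero.1 (h.natCast_le_natCast NCGraphClass.not_succ_eale h2)
    refine ⟨0, le_rfl, ?_, fun N => ?_⟩
    · refine tendsto_const_nhds.congr' ?_
      filter_upwards [eventually_ge_atTop 1] with N hN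
      rw [hα N hN, Nat.cast_zero, Real.zero_rpow]
      positivity
    · rcases Nat.eq_zero_or_pos N with rfl | hN
      · simp [alphaStar_tensorPow_zero]
      · rw [hα N hN, Nat.cast_zero]
        positivity
  · have hα : ∀ N, 1 ≤ (S.tensorPow N).alphaStar := by
      intro N
      rw [← natCast_eale_toClass_iff, toClass_tensorPow, Nat.cast_one]
      exact h.one_le_pow h1 N
    have hα' : ∀ N, (0 : ℝ) < (S.tensorPow N).alphaStar := fun N => by exact_mod_cast hα N
    have hsub : Subadditive fun N => -Real.log (S.tensorPow N).alphaStar := by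
      intro N M
      have h2 : ((S.tensorPow N).alphaStar : ℝ) * (S.tensorPow M).alphaStar ≤
          (S.tensorPow (N + M)).alphaStar := by exact_mod_cast S.alphaStar_tensorPow_mul_le N M
      have h3 := Real.log_le_log (mul_pos (hα' N) (hα' M)) h2
      rw [Real.log_mul (hα' N).ne' (hα' M).ne'] at h3
      linarith
    obtain ⟨n, hn⟩ := h.le_nat S.toClass
    have hαn : ∀ N, ((S.tensorPow N).alphaStar : ℝ) ≤ (n : ℝ) ^ N := by
      intro N
      have h2 : NCGraphClass.EALE (S.tensorPow N).alphaStar (S.tensorPow N).toClass :=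
        natCast_eale_toClass_iff.2 le_rfl
      rw [toClass_tensorPow] at h2
      have h3 := h.trans h2 (h.pow hn N)
      rw [← Nat.cast_pow] at h3
      exact_mod_cast h.natCast_le_natCast NCGraphClass.not_succ_eale h3
    have hbdd : BddBelow (Set.range fun N : ℕ => -Real.log (S.tensorPow N).alphaStar / N) := by
      refine ⟨-Real.log n, ?_⟩
      rintro _ ⟨N, rfl⟩
      rcases Nat.eq_zero_or_pos N with rfl | hN
      · have := Real.log_natCast_nonneg n
        simpa using this
      · have h2 := Real.log_le_log (hα' N) (hαn N)
        rw [Real.log_pow] at h2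
        have hN' : (0 : ℝ) < N := by exact_mod_cast hN
        change -Real.log n ≤ -Real.log (S.tensorPow N).alphaStar / N
        rw [le_div_iff₀ hN']
        linarith
    refine ⟨Real.exp (-hsub.lim), (Real.exp_pos _).le, ?_, fun N => ?_⟩
    · refine ((Real.continuous_exp.tendsto _).comp (hsub.tendsto_lim hbdd).neg).congr fun N => ?_
      rw [Function.comp_apply, Real.rpow_def_of_pos (hα' N)]
      congr 1
      ring
    · rcases Nat.eq_zero_or_pos N with rfl | hN
      · simp [alphaStar_tensorPow_zero]
      · have hN' : (0 : ℝ) < N := by exact_mod_cast hN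
        have h2 := hsub.lim_le_div hbdd hN.ne'
        rw [le_div_iff₀ hN'] at h2
        rw [← Real.exp_nat_mul, ← Real.log_le_iff_le_exp (hα' N)]
        linarith

theorem toClass_eale_one_or_two_eale (S : NCGraph) :
    NCGraphClass.EALE S.toClass 1 ∨ NCGraphClass.EALE 2 S.toClass := by
  by_cases hS : ∀ X, S.OrthTo X → X = 0
  · exact Or.inl (eale_kbar_one hS)
  · push Not at hS
    obtain ⟨X, hX, hne⟩ := hS
    refine Or.inr ?_
    rw [← Nat.cast_ofNat, NCGraphClass.natCast_eq]
    exact kbar_two_eale hX hne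

end NCGraph

theorem mainTheorem4 (S : NCGraph) :
    (∀ N : ℕ, IsGreatest {k | (S.tensorPow N).HasEAIndependentSet k} (S.tensorPow N).alphaStar) ∧
    Tendsto (fun N : ℕ => ((S.tensorPow N).alphaStar : ℝ) ^ (1 / (N : ℝ))) atTop
      (𝓝 S.thetaStar) ∧
    IsLeast ((fun φ : NCGraphClass →+* ℝ≥0 => (φ S.toClass : ℝ)) '' asymptoticSpectrumEA)
      S.thetaStar := by
  obtain ⟨θ, hθ0, htend, hθ⟩ := S.exists_tendsto_alphaStar
  have hlim : S.thetaStar = θ := htend.limUnder_eq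
  rw [hlim]
  have hlower : ∀ φ ∈ asymptoticSpectrumEA, θ ≤ (φ S.toClass : ℝ) := by
    intro φ hφ
    refine le_of_tendsto htend ?_
    filter_upwards [eventually_ge_atTop 1] with N hN
    have h1 := hφ _ _ (NCGraph.hasEAIndependentSet_iff.1 (S.tensorPow N).isGreatest_alphaStar.1)
    rw [NCGraph.toClass_tensorPow, map_pow, ← NCGraphClass.natCast_eq, map_natCast] at h1
    have h2 : ((S.tensorPow N).alphaStar : ℝ) ≤ (φ S.toClass : ℝ) ^ N := by exact_mod_cast h1
    rw [one_div]
    exact (Real.rpow_le_rpow (Nat.cast_nonneg _) h2 (by positivity)).trans_eq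
      (Real.pow_rpow_inv_natCast (φ S.toClass).2 (by omega))
  refine ⟨fun N => (S.tensorPow N).isGreatest_alphaStar, htend, ?_, ?_⟩
  · obtain ⟨φ, hφ, hle⟩ := NCGraphClass.isStrassenPreorder_eale.exists_hom_le
      NCGraphClass.not_succ_eale S.toClass_eale_one_or_two_eale hθ0 (fun k N hk => by
        rw [← NCGraph.toClass_tensorPow, NCGraph.natCast_eale_toClass_iff] at hk
        exact le_trans (by exact_mod_cast hk) (hθ N))
    have hmem : φ ∈ asymptoticSpectrumEA := fun S T h => hφ _ _ h
    exact ⟨φ, hmem, le_antisymm hle (hlower φ hmem)⟩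
  · rintro _ ⟨φ, hφ, rfl⟩
    exact hlower φ hφ
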